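/- Let $n,m\ge 2$ be integers and let $q\in\mathbb C$ with $|q|=1$. Let $\mathcal E_{n,m}^q$ be the universal unital $C^*$-algebra generated by isometries $s_1,\dots,s_n,t_1,\dots,t_m$ subject to \[ s_i^*s_j=0\ (i\neq j),\qquad t_r^*t_l=0\ (r\neq l),\qquad s_j^*t_r=q\,t_rs_j^*\quad (1\le j\le n,\ 1\le r\le m). \] Let $\mathcal M_q$ be the closed two-sided ideal of $\mathcal E_{n,m}^q$ generated by $\mathbf 1-\sum_{j=1}^n s_js_j^*$ and $\mathbf 1-\sum_{r=1}^m t_rt_r^*$, and put $\mathcal O_n\otimes_q\mathcal O_m:=\mathcal E_{n,m}^q/\mathcal M_q$. Then the $C^*$-algebra $\mathcal O_n\otimes_q\mathcal O_m$ is nuclear, simple and purely infinite (every nonzero hereditary $C^*$-subalgebra contains an infinite projection). Moreover, for every nonzero $x\in\mathcal O_n\otimes_q\mathcal O_m$ there exist $a,b\in\mathcal O_n\otimes_q\mathcal O_m$ such that $axb=\mathbf 1$. -/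

import Mathlib

open scoped ENNReal CStarAlgebra ComplexOrder

universe u

/-! ### Quotients of C⋆-algebras -/

namespace CStarQuotient

variable {A : Type*} [CStarAlgebra A] (I : Ideal A)

/-- The involution of `A ⧸ I` for a self-adjoint ideal `I`. -/
def starMap (hs : ∀ x ∈ I, star x ∈ I) : A ⧸ I → A ⧸ I :=
  Quotient.map' (s₁ := Submodule.quotientRel I) (s₂ := Submodule.quotientRel I) star (by
    intro a b h
    rw [Submodule.quotientRel_def] at h ⊢
    rw [← star_sub]
    exact hs _ h)

theorem norm_mk_le (a : A) : ‖(Submodule.Quotient.mk a : A ⧸ I)‖ ≤ ‖a‖ :=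
  Submodule.Quotient.norm_mk_le I a

theorem exists_rep (x : A ⧸ I) {ε : ℝ} (hε : 0 < ε) :
    ∃ a : A, (Submodule.Quotient.mk a : A ⧸ I) = x ∧ ‖a‖ < ‖x‖ + ε :=
  Submodule.Quotient.norm_mk_lt x hε

theorem norm_mul_le [I.IsTwoSided] (x y : A ⧸ I) : ‖x * y‖ ≤ ‖x‖ * ‖y‖ := by
  have key : ∀ ε : ℝ, 0 < ε → ‖x * y‖ ≤ (‖x‖ + ε) * (‖y‖ + ε) := by
    intro ε hε
    obtain ⟨a, rfl, ha⟩ := exists_rep I x hε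
    obtain ⟨b, rfl, hb⟩ := exists_rep I y hε
    calc _ ≤ ‖a * b‖ := norm_mk_le I (a * b)
      _ ≤ ‖a‖ * ‖b‖ := _root_.norm_mul_le a b
      _ ≤ _ := by gcongr
  have hc : Filter.Tendsto (fun ε : ℝ => (‖x‖ + ε) * (‖y‖ + ε)) (nhdsWithin 0 (Set.Ioi 0))
      (nhds ((‖x‖ + 0) * (‖y‖ + 0))) :=
    (Continuous.tendsto (by fun_prop) 0).mono_left nhdsWithin_le_nhds
  have := ge_of_tendsto hc (Filter.eventually_of_mem self_mem_nhdsWithin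
    (fun ε hε => key ε hε))
  simpa using this

/-- Elements of a closed self-adjoint ideal are almost annihilated by a contraction `1 - e`
with `e` in the ideal. -/
theorem exists_approx_unit [hI : IsClosed (I : Set A)] (hs : ∀ x ∈ I, star x ∈ I)
    {y : A} (hy : y ∈ I) {ε : ℝ} (hε : 0 < ε) :
    ∃ e ∈ I, star e = e ∧ ‖1 - e‖ ≤ 1 ∧ ‖y - y * e‖ < ε := by
  let B : NonUnitalStarSubalgebra ℂ A :=
    { carrier := I
      add_mem' := fun h h' => I.add_mem h h'
      zero_mem' := I.zero_mem
      mul_mem' := fun {a b} _ h' => I.mul_mem_left a h'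
      smul_mem' := fun c x h => by
        rw [← smul_one_mul c x]
        exact I.mul_mem_left _ h
      star_mem' := fun {a} h => hs a h }
  have hB : IsClosed (B : Set A) := hI
  obtain ⟨e, ⟨c, hc⟩, he1, hye⟩ :
      ∃ e : B, (∃ c : B, e = star c * c) ∧ ‖e‖ ≤ 1 ∧ ‖(⟨y, hy⟩ : B) - ⟨y, hy⟩ * e‖ < ε := by
    let _ := CStarAlgebra.spectralOrder B
    have _ := CStarAlgebra.spectralOrderedRing B
    have hl := CStarAlgebra.increasingApproximateUnit B
    have _ := hl.neBot
    have ht := hl.tendsto_mul_left ⟨y, hy⟩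
    rw [Metric.tendsto_nhds] at ht
    obtain ⟨e, ⟨h1, h2⟩, h3⟩ :=
      ((hl.eventually_nonneg.and hl.eventually_norm).and (ht ε hε)).exists
    rw [dist_comm, dist_eq_norm] at h3
    exact ⟨e, CStarAlgebra.nonneg_iff_eq_star_mul_self.1 h1, h2, h3⟩
  let _ := CStarAlgebra.spectralOrder A
  have _ := CStarAlgebra.spectralOrderedRing A
  have he0 : (0 : A) ≤ (e : A) := by
    rw [hc]
    exact star_mul_self_nonneg (c : A)
  have hle : (e : A) ≤ 1 := (CStarAlgebra.norm_le_one_iff_of_nonneg _ he0).1 he1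
  exact ⟨e, e.2, (IsSelfAdjoint.of_nonneg he0).star_eq,
    (CStarAlgebra.norm_le_one_iff_of_nonneg _ (sub_nonneg.2 hle)).2 (sub_le_self _ he0), hye⟩

theorem norm_sq_le [I.IsTwoSided] [hI : IsClosed (I : Set A)] (hs : ∀ x ∈ I, star x ∈ I) (a : A) :
    ‖(Submodule.Quotient.mk a : A ⧸ I)‖ * ‖(Submodule.Quotient.mk a : A ⧸ I)‖ ≤
      ‖(Submodule.Quotient.mk (star a * a) : A ⧸ I)‖ := by
  refine le_of_forall_pos_le_add fun ε hε => ?_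
  obtain ⟨b, hb, hbn⟩ := exists_rep I (Submodule.Quotient.mk (star a * a)) (half_pos hε)
  have hy : star a * a - b ∈ I := (Submodule.Quotient.eq I).1 hb.symm
  obtain ⟨e, heI, hes, hen, hye⟩ := exists_approx_unit I hs hy (half_pos hε)
  have hmk : (Submodule.Quotient.mk a : A ⧸ I) = Submodule.Quotient.mk (a * (1 - e)) := by
    rw [Submodule.Quotient.eq, mul_sub, mul_one, sub_sub_cancel]
    exact I.mul_mem_left a heI
  have hst : star (1 - e) = 1 - e := by rw [star_sub, star_one, hes]
  calc _ ≤ ‖a * (1 - e)‖ * ‖a * (1 - e)‖ := by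
        rw [hmk]
        gcongr <;> exact norm_mk_le I _
    _ = ‖star (a * (1 - e)) * (a * (1 - e))‖ := CStarRing.norm_star_mul_self.symm
    _ = ‖(1 - e) * b * (1 - e) + (1 - e) * ((star a * a - b) - (star a * a - b) * e)‖ := by
        rw [star_mul, hst]
        congr 1
        simp only [mul_sub, sub_mul, mul_one, one_mul, mul_assoc]
        abel
    _ ≤ ‖1 - e‖ * ‖b‖ * ‖1 - e‖ + ‖1 - e‖ * ‖(star a * a - b) - (star a * a - b) * e‖ := by
        refine (norm_add_le _ _).trans (add_le_add ?_ (_root_.norm_mul_le _ _))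
        refine (_root_.norm_mul_le _ _).trans ?_
        gcongr
        exact _root_.norm_mul_le _ _
    _ ≤ 1 * ‖b‖ * 1 + 1 * (ε / 2) := by
        gcongr
    _ ≤ _ := by linarith

/-- `A ⧸ I` with the quotient norm. -/
noncomputable abbrev normedRing [I.IsTwoSided] [hI : IsClosed (I : Set A)] :
    NormedRing (A ⧸ I) :=
  { Ideal.Quotient.ring I, Submodule.Quotient.normedAddCommGroup I with
    norm_mul_le := norm_mul_le I }

/-- The quotient of a unital C⋆-algebra by a closed self-adjoint two-sided ideal, with the quotient
norm, as a C⋆-algebra. -/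
noncomputable abbrev cstarAlgebra [I.IsTwoSided] [hI : IsClosed (I : Set A)]
    (hs : ∀ x ∈ I, star x ∈ I) : CStarAlgebra (A ⧸ I) :=
  { normedRing I, Ideal.Quotient.algebra ℂ with
    norm_smul_le := (Submodule.Quotient.normedSpace I ℂ).norm_smul_le
    star := starMap I hs
    star_involutive := by
      rintro ⟨a⟩
      exact congrArg (Submodule.Quotient.mk (p := I)) (star_star a)
    star_mul := by
      rintro ⟨a⟩ ⟨b⟩
      exact congrArg (Submodule.Quotient.mk (p := I)) (star_mul a b)
    star_add := by
      rintro ⟨a⟩ ⟨b⟩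
      exact congrArg (Submodule.Quotient.mk (p := I)) (star_add a b)
    star_smul := by
      rintro c ⟨a⟩
      exact congrArg (Submodule.Quotient.mk (p := I)) (star_smul c a)
    norm_mul_self_le := by
      rintro ⟨a⟩
      exact norm_sq_le I hs a
    complete := (Submodule.Quotient.completeSpace I).complete }

end CStarQuotient

/-! ### Nuclear and purely infinite C⋆-algebras -/

section Properties

variable (A : Type*) [CStarAlgebra A] [PartialOrder A] [StarOrderedRing A]

/-- A C⋆-algebra is nuclear if its identity map is a point-norm limit of compositions
`A → M_k(ℂ) → A` of contractive completely positive maps. -/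
def IsNuclearCStar : Prop :=
  ∀ (F : Finset A) (ε : ℝ), 0 < ε →
    ∃ (k : ℕ) (φ : A →CP CStarMatrix (Fin k) (Fin k) ℂ)
      (ψ : CStarMatrix (Fin k) (Fin k) ℂ →CP A),
      (∀ a, ‖φ a‖ ≤ ‖a‖) ∧ (∀ T, ‖ψ T‖ ≤ ‖T‖) ∧ ∀ a ∈ F, ‖ψ (φ a) - a‖ < ε

variable {A}

/-- A projection is infinite if it is Murray-von Neumann equivalent to a proper subprojection of
itself. -/
def IsInfiniteProjection (p : A) : Prop :=
  IsStarProjection p ∧ ∃ v : A, star v * v = p ∧ v * star v < p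

/-- Hereditary C⋆-subalgebras. -/
structure IsHereditaryCStarSubalgebra (B : NonUnitalStarSubalgebra ℂ A) : Prop where
  isClosed : IsClosed (B : Set A)
  mem_of_le : ∀ a b : A, 0 ≤ a → a ≤ b → b ∈ B → a ∈ B

variable (A)

/-- Pure infiniteness (of a simple C⋆-algebra): every nonzero hereditary C⋆-subalgebra contains an
infinite projection. -/
def IsPurelyInfiniteCStar : Prop :=
  ∀ B : NonUnitalStarSubalgebra ℂ A, IsHereditaryCStarSubalgebra B → B ≠ ⊥ →
    ∃ p ∈ B, IsInfiniteProjection p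

end Properties

/-! ### The C⋆-algebra `𝓔_{n,m}^q` -/

/-- Two families of isometries with pairwise orthogonal ranges that satisfy
`s_j^* t_r = q t_r s_j^*`. -/
structure IsQTwistedPair {A : Type*} [CStarAlgebra A] {n m : ℕ} (q : ℂ)
    (s : Fin n → A) (t : Fin m → A) : Prop where
  star_s_mul_s : ∀ i j, star (s i) * s j = if i = j then 1 else 0
  star_t_mul_t : ∀ i j, star (t i) * t j = if i = j then 1 else 0
  star_s_mul_t : ∀ j r, star (s j) * t r = q • (t r * star (s j))

/-- A representation of the relations in some nonzero unital C⋆-algebra. -/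
structure QTwistedRep (n m : ℕ) (q : ℂ) where
  /-- the target -/
  alg : Type u
  [cstar : CStarAlgebra alg]
  [nontrivial : Nontrivial alg]
  /-- the first family -/
  s : Fin n → alg
  /-- the second family -/
  t : Fin m → alg
  rel : IsQTwistedPair q s t

attribute [instance] QTwistedRep.cstar QTwistedRep.nontrivial

theorem norm_le_one_of_star_mul_self {A : Type*} [CStarAlgebra A] [Nontrivial A] {a : A}
    (h : star a * a = 1) : ‖a‖ ≤ 1 := by
  have h1 : ‖a‖ * ‖a‖ = 1 := by rw [← CStarRing.norm_star_mul_self, h, norm_one]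
  nlinarith [norm_nonneg a]

namespace QTwisted

variable (n m : ℕ) (q : ℂ)

/-- The `ℓ^∞`-direct sum of all C⋆-algebras in which the relations are represented. -/
abbrev Ambient : Type (u + 1) := lp (fun ρ : QTwistedRep.{u} n m q => ρ.alg) ∞

noncomputable instance : CStarAlgebra (Ambient.{u} n m q) where

/-- The direct sum of all representations, on the first family of generators. -/
def ambientS (j : Fin n) : Ambient.{u} n m q :=
  ⟨fun ρ => ρ.s j, memℓp_infty ⟨1, by
    rintro _ ⟨ρ, rfl⟩
    exact norm_le_one_of_star_mul_self (by rw [ρ.rel.star_s_mul_s, if_pos rfl])⟩⟩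

/-- The direct sum of all representations, on the second family of generators. -/
def ambientT (r : Fin m) : Ambient.{u} n m q :=
  ⟨fun ρ => ρ.t r, memℓp_infty ⟨1, by
    rintro _ ⟨ρ, rfl⟩
    exact norm_le_one_of_star_mul_self (by rw [ρ.rel.star_t_mul_t, if_pos rfl])⟩⟩

/-- The closed unital `*`-subalgebra generated by the two families. -/
noncomputable def universalSubalgebra : StarSubalgebra ℂ (Ambient.{u} n m q) :=
  (StarAlgebra.adjoin ℂ
    (Set.range (ambientS.{u} n m q) ∪ Set.range (ambientT.{u} n m q))).topologicalClosure

instance : IsClosed (universalSubalgebra.{u} n m q : Set (Ambient.{u} n m q)) :=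
  StarSubalgebra.isClosed_topologicalClosure _

/-- The universal unital C⋆-algebra `𝓔_{n,m}^q` generated by isometries `s_1, …, s_n` and
`t_1, …, t_m` subject to `s_i^* s_j = 0` and `t_i^* t_j = 0` for `i ≠ j`, and
`s_j^* t_r = q t_r s_j^*`: the closure of the image of the free `*`-algebra under the direct sum of
all representations of the relations. Its universal property is `QTwisted.existsUnique_lift`. -/
abbrev Universal : Type (u + 1) := universalSubalgebra.{u} n m q

/-- The generators `s_j` of `𝓔_{n,m}^q`. -/
noncomputable def genS (j : Fin n) : Universal.{u} n m q :=
  ⟨ambientS n m q j, StarSubalgebra.le_topologicalClosure _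
    (StarAlgebra.subset_adjoin ℂ _ (Or.inl ⟨j, rfl⟩))⟩

/-- The generators `t_r` of `𝓔_{n,m}^q`. -/
noncomputable def genT (r : Fin m) : Universal.{u} n m q :=
  ⟨ambientT n m q r, StarSubalgebra.le_topologicalClosure _
    (StarAlgebra.subset_adjoin ℂ _ (Or.inr ⟨r, rfl⟩))⟩

theorem isQTwistedPair_gen : IsQTwistedPair q (genS.{u} n m q) (genT.{u} n m q) where
  star_s_mul_s i j := by
    apply Subtype.ext
    apply lp.ext
    funext ρ
    have := ρ.rel.star_s_mul_s i j
    split_ifs at this ⊢ <;> exact this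
  star_t_mul_t i j := by
    apply Subtype.ext
    apply lp.ext
    funext ρ
    have := ρ.rel.star_t_mul_t i j
    split_ifs at this ⊢ <;> exact this
  star_s_mul_t j r := by
    apply Subtype.ext
    apply lp.ext
    funext ρ
    exact ρ.rel.star_s_mul_t j r

/-- Evaluation of `𝓔_{n,m}^q` at one representation. -/
noncomputable def eval (ρ : QTwistedRep.{u} n m q) : Universal.{u} n m q →⋆ₐ[ℂ] ρ.alg where
  toFun x := x.1 ρ
  map_one' := rfl
  map_mul' _ _ := rfl
  map_zero' := rfl
  map_add' _ _ := rfl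
  commutes' _ := rfl
  map_star' _ := rfl

/-- The universal property of `𝓔_{n,m}^q`. -/
theorem existsUnique_lift {A : Type u} [CStarAlgebra A] [Nontrivial A] (s : Fin n → A)
    (t : Fin m → A) (h : IsQTwistedPair q s t) :
    ∃! φ : Universal.{u} n m q →⋆ₐ[ℂ] A,
      (∀ j, φ (genS n m q j) = s j) ∧ ∀ r, φ (genT n m q r) = t r := by
  refine ⟨eval n m q ⟨A, s, t, h⟩, ⟨fun _ => rfl, fun _ => rfl⟩, ?_⟩
  rintro ψ ⟨hs, ht⟩
  have hψ : Continuous ψ := map_continuous ψ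
  have hφ : Continuous (eval n m q ⟨A, s, t, h⟩) := map_continuous _
  refine StarAlgHom.ext_topologicalClosure hψ hφ ?_
  refine StarAlgHom.ext_adjoin ?_
  rintro ⟨x, hx⟩ (⟨j, rfl⟩ | ⟨r, rfl⟩)
  · exact hs j
  · exact ht r

/-! ### The ideal `𝓜_q` and the quotient -/

/-- `Q = ∑ s_j s_j^*`. -/
noncomputable def rangeS : Universal.{u} n m q := ∑ j, genS n m q j * star (genS n m q j)

/-- `P = ∑ t_r t_r^*`. -/
noncomputable def rangeT : Universal.{u} n m q := ∑ r, genT n m q r * star (genT n m q r)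

/-- The closed two-sided ideal `𝓜_q` generated by `1 - Q` and `1 - P`. -/
noncomputable def idealM : Ideal (Universal.{u} n m q) :=
  sInf {I | I.IsTwoSided ∧ IsClosed (I : Set (Universal.{u} n m q)) ∧
    1 - rangeS n m q ∈ I ∧ 1 - rangeT n m q ∈ I}

instance : (idealM.{u} n m q).IsTwoSided where
  mul_mem_of_left b h := by
    simp only [idealM, Submodule.mem_sInf] at h ⊢
    intro I hI
    exact hI.1.mul_mem_of_left b (h I hI)

instance : IsClosed (idealM.{u} n m q : Set (Universal.{u} n m q)) := by
  rw [idealM, Submodule.coe_sInf]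
  exact isClosed_biInter fun I hI => hI.2.1

theorem star_mem_idealM : ∀ x ∈ idealM.{u} n m q, star x ∈ idealM.{u} n m q := by
  intro x hx
  simp only [idealM, Submodule.mem_sInf] at hx ⊢
  intro I hI
  have _ := hI.1
  let J : Ideal (Universal.{u} n m q) :=
    { carrier := {y | star y ∈ I}
      add_mem' := fun {a b} ha hb => by
        simpa only [Set.mem_ofPred_eq, star_add] using I.add_mem ha hb
      zero_mem' := by simp only [Set.mem_ofPred_eq, star_zero]; exact I.zero_mem
      smul_mem' := fun c y hy => by
        simpa only [Set.mem_ofPred_eq, smul_eq_mul, star_mul] using Ideal.mul_mem_right _ I hy }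
  refine hx J ⟨⟨fun b h => ?_⟩, hI.2.1.preimage continuous_star, ?_, ?_⟩
  · change star _ ∈ I
    rw [star_mul]
    exact Ideal.mul_mem_left I _ h
  · change star _ ∈ I
    simpa [rangeS] using hI.2.2.1
  · change star _ ∈ I
    simpa [rangeT] using hI.2.2.2

end QTwisted

/-- The C⋆-algebra `𝓞_n ⊗_q 𝓞_m = 𝓔_{n,m}^q / 𝓜_q`. -/
def CuntzQTensor (n m : ℕ) (q : ℂ) : Type (u + 1) :=
  QTwisted.Universal.{u} n m q ⧸ QTwisted.idealM.{u} n m q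

namespace CuntzQTensor

variable (n m : ℕ) (q : ℂ)

noncomputable instance : CStarAlgebra (CuntzQTensor.{u} n m q) :=
  CStarQuotient.cstarAlgebra (QTwisted.idealM.{u} n m q) (QTwisted.star_mem_idealM n m q)

/-- The usual order of a C⋆-algebra. -/
noncomputable instance : PartialOrder (CuntzQTensor.{u} n m q) :=
  CStarAlgebra.spectralOrder _

instance : StarOrderedRing (CuntzQTensor.{u} n m q) :=
  CStarAlgebra.spectralOrderedRing _

end CuntzQTensor

/-!
The algebra `A = 𝓞_n ⊗_q 𝓞_m` is generated by two Cuntz families `s`, `t`. Because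
`∑ s_j s_j^* = 1`, the relation `s_j^* t_r = q t_r s_j^*` also gives `t_r s_j = q s_j t_r`, so
every letter of one family commutes with every letter of the other up to a scalar. Hence the words
`s_μ s_μ'^* t_ν t_ν'^*`, graded by their lengths, span a dense `*`-subalgebra, in which the phases
never matter as long as one computes with spans of words instead of single words: the spans of the
two families commute (`IsQCuntzPair.commute_wordSpan`).

For `i ≠ j` and `k ≠ l` put `z_d = (s_i t_k)^d s_j t_l`. For a fixed word `x` and large `d`, the
compression `z_d^* x z_d` is a scalar independent of `d`, which vanishes if `x` is unbalanced,
that is, if `|μ| ≠ |μ'|` or `|ν| ≠ |ν'|`. Therefore `z_d^* x z_d` converges in norm to `ω(x) 1` for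
every `x` in `A`, and `ω` is a state that vanishes on unbalanced words
(`IsQCuntzPair.exists_balanced_state`). This one sequence of isometries serves instead of the gauge
action, its conditional expectation and the gauge-invariant states.

Let `w_a` run through the words `s_μ t_ν` whose two lengths lie in `{K, …, 2K}`. They are
orthonormal for `ω`, so `φ(x) = (ω(w_a^* x w_b))_{a,b}` is a unital completely positive contraction
into a matrix algebra, and so is `ψ(T) = (K+1)^{-2} ∑ T_{ab} w_a w_b^*` in the other direction. For
a word `x` of degree `(g, g')` and large `K`, the element `ψ(φ(x))` is
`(1 - |g|/(K+1)) (1 - |g'|/(K+1)) x`, whence `ψ ∘ φ` tends to the identity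
(`IsQCuntzPair.exists_state_approx`). This is nuclearity.

The same approximation shows that for `x ≠ 0` some `ω(w_a^* x w_b)` is nonzero. Then
`z_d^* w_a^* x w_b z_d` is close to a nonzero scalar for large `d`, hence invertible, which gives
`a x b = 1` and simplicity. By the Cauchy-Schwarz inequality `ω((x w_b)^* (x w_b))` is nonzero too,
so there is `c` such that `r = x c` is an isometry (`IsQCuntzPair.exists_isometry_mul`); its range
projection lies in every hereditary subalgebra that contains `x`, and it is infinite because
`1` is.

That `A` is nonzero follows from weighted shifts on `ℓ²(ℤ × ℕ × ℕ)`
(`exists_twisted_cuntzFamilies`).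
-/

/-! ### Positive matrices and the Schwarz inequality -/

theorem CStarAlgebra.exists_eq_star_mul_self {B : Type*} [NonUnitalCStarAlgebra B]
    [PartialOrder B] [StarOrderedRing B] {a : B} (h : 0 ≤ a) : ∃ b, a = star b * b :=
  CStarAlgebra.nonneg_iff_eq_star_mul_self.mp h

/-- Unital completely positive maps are contractive, given the Schwarz inequality. -/
theorem CompletelyPositiveMap.norm_le_of_schwarz {B C : Type*} [CStarAlgebra B] [PartialOrder B]
    [StarOrderedRing B] [CStarAlgebra C] [PartialOrder C] [StarOrderedRing C] (φ : B →CP C)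
    (h1 : φ 1 = 1) {x : B} (h2 : star (φ x) * φ x ≤ φ (star x * x)) : ‖φ x‖ ≤ ‖x‖ := by
  have h3 : φ (star x * x) ≤ algebraMap ℝ _ (‖x‖ ^ 2) := by
    have := OrderHomClass.mono φ (CStarAlgebra.star_mul_le_algebraMap_norm_sq (a := x))
    rwa [Algebra.algebraMap_eq_smul_one, ← Complex.coe_smul, map_smul, h1, Complex.coe_smul,
      ← Algebra.algebraMap_eq_smul_one] at this
  have h4 : ‖star (φ x) * φ x‖ ≤ ‖x‖ ^ 2 :=
    (CStarAlgebra.norm_le_iff_le_algebraMap _ (sq_nonneg _) (star_mul_self_nonneg _)).2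
      (h2.trans h3)
  rw [CStarRing.norm_star_mul_self, ← sq] at h4
  exact (sq_le_sq₀ (norm_nonneg _) (norm_nonneg _)).1 h4

namespace CStarMatrix

open scoped MatrixOrder in
theorem nonneg_of_posSemidef {N : ℕ} {M : CStarMatrix (Fin N) (Fin N) ℂ}
    (h : (ofMatrix.symm M).PosSemidef) : 0 ≤ M := by
  obtain ⟨B, hB⟩ := CStarAlgebra.nonneg_iff_eq_star_mul_self.mp h.nonneg
  have : M = star (ofMatrix B) * ofMatrix B := hB
  rw [this]
  exact star_mul_self_nonneg _

/-- A block matrix whose scalar entries form a positive semidefinite matrix is positive. -/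
theorem nonneg_of_posSemidef_blocks {k N : ℕ}
    {M : CStarMatrix (Fin k) (Fin k) (CStarMatrix (Fin N) (Fin N) ℂ)}
    (h : (Matrix.of fun p r : Fin k × Fin N => M p.1 r.1 p.2 r.2).PosSemidef) : 0 ≤ M := by
  open scoped MatrixOrder in
  obtain ⟨B, hB⟩ := CStarAlgebra.nonneg_iff_eq_star_mul_self.mp h.nonneg
  let C : CStarMatrix (Fin k) (Fin k) (CStarMatrix (Fin N) (Fin N) ℂ) :=
    ofMatrix (Matrix.of fun i j => ofMatrix (Matrix.of fun a b => B (i, a) (j, b)))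
  have : M = star C * C := by
    ext i j a b : 2
    have := congrFun (congrFun hB (i, a)) (j, b)
    simp only [Matrix.of_apply, Matrix.star_eq_conjTranspose, Matrix.mul_apply,
      Matrix.conjTranspose_apply] at this
    rw [this, Fintype.sum_prod_type]
    rw [mul_apply]
    have hsum : ∀ f : Fin k → CStarMatrix (Fin N) (Fin N) ℂ,
        (∑ i, f i) a b = ∑ i, f i a b := fun f => Matrix.sum_apply a b Finset.univ f
    rw [hsum]
    rfl
  rw [this]
  exact star_mul_self_nonneg _

end CStarMatrix

/-! ### Completely positive maps to and from matrix algebras -/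

section CompletelyPositive

variable {A : Type*} [CStarAlgebra A]

/-- A state of a unital C⋆-algebra. -/
structure IsState (ω : A →ₗ[ℂ] ℂ) : Prop where
  nonneg : ∀ x, 0 ≤ ω (star x * x)
  map_star : ∀ x, ω (star x) = star (ω x)
  map_one : ω 1 = 1

variable {ω : A →ₗ[ℂ] ℂ}

/-- The matrix `(ω (w_a^* x w_b))_{a,b}`: the compression of `x` to the span of the vectors `w_a`
in the GNS representation of `ω`. -/
noncomputable def compressFun (ω : A →ₗ[ℂ] ℂ) {N : ℕ} (w : Fin N → A) :
    A →ₗ[ℂ] CStarMatrix (Fin N) (Fin N) ℂ where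
  toFun x := CStarMatrix.ofMatrix (Matrix.of fun a b => ω (star (w a) * x * w b))
  map_add' x y := by
    ext a b : 1
    exact (congrArg ω (by rw [mul_add, add_mul])).trans (map_add ω _ _)
  map_smul' c x := by
    ext a b : 1
    exact (congrArg ω (by rw [mul_smul_comm, smul_mul_assoc])).trans (map_smul ω c _)

/-- Gram matrices with respect to a state are positive semidefinite. -/
theorem IsState.posSemidef_gram (hω : IsState ω) {ι κ : Type*} [Fintype ι] [Fintype κ]
    (y : κ → ι → A) : (Matrix.of fun a b => ∑ r, ω (star (y r a) * y r b)).PosSemidef := by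
  refine .of_dotProduct_mulVec_nonneg ?_ fun c => ?_
  · ext a b
    simp only [Matrix.conjTranspose_apply, Matrix.of_apply, star_sum, ← hω.map_star, star_mul,
      star_star]
  · have : star c ⬝ᵥ (Matrix.of fun a b => ∑ r, ω (star (y r a) * y r b)).mulVec c =
        ∑ r, ω (star (∑ a, c a • y r a) * ∑ b, c b • y r b) := by
      simp only [dotProduct, Matrix.mulVec, Matrix.of_apply, star_sum, map_sum, star_smul,
        smul_mul_smul_comm, map_smul, smul_eq_mul, Finset.mul_sum, Finset.sum_mul, Pi.star_apply]
      conv_lhs => enter [2, a]; rw [Finset.sum_comm]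
      rw [Finset.sum_comm]
      refine Finset.sum_congr rfl fun r _ => ?_
      rw [Finset.sum_comm]
      refine Finset.sum_congr rfl fun a _ => Finset.sum_congr rfl fun b _ => ?_
      ring
    rw [this]
    exact Finset.sum_nonneg fun r _ => hω.nonneg _

variable [PartialOrder A] [StarOrderedRing A]

/-- `compressFun` as a completely positive map. -/
noncomputable def compressCP (hω : IsState ω) {N : ℕ} (w : Fin N → A) :
    A →CP CStarMatrix (Fin N) (Fin N) ℂ where
  __ := compressFun ω w
  map_cstarMatrix_nonneg' k M hM := by
    obtain ⟨B, rfl⟩ := CStarAlgebra.exists_eq_star_mul_self hM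
    apply CStarMatrix.nonneg_of_posSemidef_blocks
    convert hω.posSemidef_gram (fun (r : Fin k) (p : Fin k × Fin N) => B r p.1 * w p.2) using 1
    ext p r
    simp only [Matrix.of_apply]
    change ω (star (w p.2) * (star B * B) p.1 r.1 * w r.2) = _
    rw [CStarMatrix.mul_apply, Finset.mul_sum, Finset.sum_mul, map_sum]
    refine Finset.sum_congr rfl fun i _ => congrArg ω ?_
    rw [CStarMatrix.star_apply, star_mul]
    simp only [mul_assoc]

theorem compressCP_apply (hω : IsState ω) {N : ℕ} (w : Fin N → A) (x : A) (a b : Fin N) :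
    compressCP hω w x a b = ω (star (w a) * x * w b) := rfl

theorem norm_compressCP_le (hω : IsState ω) {N : ℕ} {w : Fin N → A}
    (hw : ∀ a b, ω (star (w a) * w b) = if a = b then 1 else 0) (x : A) :
    ‖compressCP hω w x‖ ≤ ‖x‖ := by
  set φ := compressCP hω w with hφ
  have h1 : φ 1 = 1 := by
    ext a b : 1
    rw [compressCP_apply, mul_one, hw]
    rfl
  -- The Schwarz inequality for `φ` is Bessel's inequality for the orthonormal vectors `w a`.
  have h2 : star (φ x) * φ x ≤ φ (star x * x) := by
    rw [← sub_nonneg]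
    apply CStarMatrix.nonneg_of_posSemidef
    convert hω.posSemidef_gram (κ := Unit)
      (fun _ b => x * w b - ∑ c, ω (star (w c) * (x * w b)) • w c) using 1
    ext a b
    have e1 : ∀ y z : A, ω (star (y - ∑ c, ω (star (w c) * y) • w c) *
        (z - ∑ c, ω (star (w c) * z) • w c)) =
        ω (star y * z) - ∑ c, star (ω (star (w c) * y)) * ω (star (w c) * z) := by
      intro y z
      have e2 : ∀ c, ω (star y * w c) = star (ω (star (w c) * y)) := by
        intro c
        rw [← hω.map_star, star_mul, star_star]
      simp only [star_sub, star_sum, star_smul, sub_mul, mul_sub, Finset.mul_sum, Finset.sum_mul,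
        map_sub, map_sum, mul_smul_comm, smul_mul_assoc, map_smul, smul_eq_mul, hw, e2]
      simp [mul_comm]
    simp only [Matrix.of_apply, Finset.univ_unique, Finset.sum_const, Finset.card_singleton,
      one_smul, e1]
    change φ (star x * x) a b - (star (φ x) * φ x) a b = _
    rw [CStarMatrix.mul_apply, compressCP_apply, star_mul]
    simp only [CStarMatrix.star_apply, hφ, compressCP_apply, mul_assoc]
  exact CompletelyPositiveMap.norm_le_of_schwarz φ h1 h2

/-- `T ↦ ∑ T_{ab} w_a w_b^*`. -/
noncomputable def synthFun {N : ℕ} (w : Fin N → A) : CStarMatrix (Fin N) (Fin N) ℂ →ₗ[ℂ] A where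
  toFun T := ∑ a, ∑ b, T a b • (w a * star (w b))
  map_add' S T := by simp [add_smul, Finset.sum_add_distrib]
  map_smul' c T := by simp [mul_smul, Finset.smul_sum]

/-- `synthFun` as a completely positive map. -/
noncomputable def synthCP {N : ℕ} (w : Fin N → A) : CStarMatrix (Fin N) (Fin N) ℂ →CP A where
  __ := synthFun w
  map_cstarMatrix_nonneg' k M hM := by
    obtain ⟨B, rfl⟩ := CStarAlgebra.exists_eq_star_mul_self hM
    let Y (c : Fin N) : CStarMatrix (Fin k) (Fin k) A :=
      CStarMatrix.ofMatrix (Matrix.of fun r i => ∑ b, B r i c b • star (w b))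
    have : (star B * B).map (synthFun w) = ∑ c, star (Y c) * Y c := by
      ext i j
      have hsum : (∑ c, star (Y c) * Y c) i j = ∑ c, (star (Y c) * Y c) i j :=
        Matrix.sum_apply i j Finset.univ fun c => star (Y c) * Y c
      rw [hsum, CStarMatrix.map_apply, CStarMatrix.mul_apply, map_sum]
      simp only [CStarMatrix.mul_apply]
      rw [Finset.sum_comm]
      refine Finset.sum_congr rfl fun r _ => ?_
      have hY : ∀ c, star (Y c) i r * Y c r j =
          ∑ a, ∑ b, (star (B r i c a) * B r j c b) • (w a * star (w b)) := by
        intro c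
        have h1 : Y c r j = ∑ b, B r j c b • star (w b) := rfl
        have h2 : star (Y c) i r = ∑ b, star (B r i c b) • w b := by
          change star (∑ b, B r i c b • star (w b)) = _
          simp [star_sum, star_smul]
        rw [h1, h2, Finset.sum_mul_sum]
        simp only [smul_mul_smul_comm]
      simp only [hY]
      have hS : synthFun w (star B i r * B r j) =
          ∑ a, ∑ b, ∑ c, (star (B r i c a) * B r j c b) • (w a * star (w b)) := by
        change ∑ a, ∑ b, (star B i r * B r j) a b • (w a * star (w b)) = _
        refine Finset.sum_congr rfl fun a _ => Finset.sum_congr rfl fun b _ => ?_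
        rw [CStarMatrix.mul_apply, Finset.sum_smul]
        rfl
      rw [hS]
      conv_lhs => enter [2, a]; rw [Finset.sum_comm]
      rw [Finset.sum_comm]
    change 0 ≤ (star B * B).map (synthFun w)
    rw [this]
    exact Finset.sum_nonneg fun c _ => star_mul_self_nonneg _

theorem synthCP_apply {N : ℕ} (w : Fin N → A) (T : CStarMatrix (Fin N) (Fin N) ℂ) :
    synthCP w T = ∑ a, ∑ b, T a b • (w a * star (w b)) := rfl

theorem norm_synthCP_le {N : ℕ} {w : Fin N → A} (hw : ∑ a, w a * star (w a) = 1)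
    (T : CStarMatrix (Fin N) (Fin N) ℂ) : ‖synthCP w T‖ ≤ ‖T‖ := by
  set ψ := synthCP w with hψ
  have h1 : ψ 1 = 1 := by
    rw [hψ, synthCP_apply, ← hw]
    simp [CStarMatrix.one_apply, ite_smul]
  -- The Schwarz inequality for `ψ`: the defect is a sum of squares.
  have h2 : star (ψ T) * ψ T ≤ ψ (star T * T) := by
    rw [← sub_nonneg]
    let y (a : Fin N) : A := ∑ b, T a b • star (w b)
    have hy : ψ T = ∑ a, w a * y a := by
      simp only [hψ, synthCP_apply, y, Finset.mul_sum, mul_smul_comm]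
    have hyy : ψ (star T * T) = ∑ c, star (y c) * y c := by
      simp only [hψ, synthCP_apply, y, star_sum, star_smul, star_star, Finset.sum_mul_sum,
        smul_mul_smul_comm, CStarMatrix.mul_apply, Finset.sum_smul, CStarMatrix.star_apply]
      conv_lhs => enter [2, a]; rw [Finset.sum_comm]
      rw [Finset.sum_comm]
    have hy' : star (ψ T) = ∑ a, star (y a) * star (w a) := by
      simp only [hy, star_sum, star_mul]
    have : ψ (star T * T) - star (ψ T) * ψ T =
        ∑ a, star (y a - star (w a) * ψ T) * (y a - star (w a) * ψ T) := by
      have e : ∀ a, star (y a - star (w a) * ψ T) * (y a - star (w a) * ψ T) =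
          star (y a) * y a - star (ψ T) * (w a * y a) - (star (y a) * star (w a)) * ψ T +
            star (ψ T) * (w a * star (w a)) * ψ T := by
        intro a
        simp only [star_sub, star_mul, star_star]
        noncomm_ring
      simp only [e, Finset.sum_add_distrib, Finset.sum_sub_distrib, ← Finset.mul_sum,
        ← Finset.sum_mul, hw, ← hy, ← hy', ← hyy, mul_one]
      abel
    rw [this]
    exact Finset.sum_nonneg fun a _ => star_mul_self_nonneg _
  exact CompletelyPositiveMap.norm_le_of_schwarz ψ h1 h2

end CompletelyPositive

/-! ### Words in Cuntz families -/

section Words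

variable {A : Type*} [CStarAlgebra A]

/-- Isometries whose ranges are pairwise orthogonal and add up to the whole space. -/
structure IsCuntzFamily {ι : Type*} [Fintype ι] [DecidableEq ι] (w : ι → A) : Prop where
  orthogonal : ∀ a b, star (w a) * w b = if a = b then 1 else 0
  total : ∑ a, w a * star (w a) = 1

theorem IsCuntzFamily.mul {ι κ : Type*} [Fintype ι] [DecidableEq ι] [Fintype κ] [DecidableEq κ]
    {w : ι → A} {v : κ → A} (hw : IsCuntzFamily w) (hv : IsCuntzFamily v) :
    IsCuntzFamily fun p : ι × κ => w p.1 * v p.2 where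
  orthogonal a b := by
    rw [star_mul, mul_assoc, ← mul_assoc (star (w a.1)), hw.orthogonal]
    by_cases h1 : a.1 = b.1
    · simp [h1, hv.orthogonal, Prod.ext_iff]
    · simp [h1, Prod.ext_iff]
  total := by
    have : ∀ p : ι × κ, w p.1 * v p.2 * star (w p.1 * v p.2) =
        w p.1 * (v p.2 * star (v p.2)) * star (w p.1) := fun p => by
      simp only [star_mul, mul_assoc]
    simp only [this, Fintype.sum_prod_type, ← Finset.sum_mul, ← Finset.mul_sum, hv.total,
      mul_one, hw.total]

theorem IsCuntzFamily.comp_equiv {ι κ : Type*} [Fintype ι] [DecidableEq ι] [Fintype κ]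
    [DecidableEq κ] {w : ι → A} (hw : IsCuntzFamily w) (e : κ ≃ ι) : IsCuntzFamily (w ∘ e) where
  orthogonal a b := by simp [hw.orthogonal]
  total := by
    rw [← hw.total]
    exact e.sum_comp fun a => w a * star (w a)

theorem Submodule.star_mem_mul {M M' N N' : Submodule ℂ A} (hM : ∀ x ∈ M, star x ∈ M')
    (hN : ∀ x ∈ N, star x ∈ N') : ∀ x ∈ M * N, star x ∈ N' * M' := by
  intro x hx
  induction hx using Submodule.mul_induction_on' with
  | mem_mul_mem a ha b hb =>
    rw [star_mul]
    exact Submodule.mul_mem_mul (hN _ hb) (hM _ ha)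
  | add a _ b _ ha hb => simpa using add_mem ha hb

theorem Submodule.star_mem_pow {M M' : Submodule ℂ A} (hM : ∀ x ∈ M, star x ∈ M') (d : ℕ) :
    ∀ x ∈ M ^ d, star x ∈ M' ^ d := by
  induction d with
  | zero =>
    intro x hx
    rw [pow_zero, Submodule.mem_one] at hx ⊢
    obtain ⟨c, rfl⟩ := hx
    exact ⟨star c, algebraMap_star_comm c⟩
  | succ d ih =>
    rw [pow_succ, pow_succ']
    exact Submodule.star_mem_mul ih hM

/-- If `R L` consists of scalars, then adjacent powers of `R` and `L` cancel. -/
theorem Submodule.pow_mul_pow_le_of_mul_le_one {R L : Submodule ℂ A} (h : R * L ≤ 1) (i j : ℕ) :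
    R ^ i * L ^ j ≤ L ^ (j - i) * R ^ (i - j) := by
  induction i generalizing j with
  | zero => simp
  | succ i ih =>
    cases j with
    | zero => simp
    | succ j =>
      calc R ^ (i + 1) * L ^ (j + 1) = R ^ i * (R * L) * L ^ j := by
            rw [pow_succ, pow_succ']; simp only [mul_assoc]
        _ ≤ R ^ i * 1 * L ^ j := by gcongr
        _ ≤ _ := by simpa using ih j

variable {n : ℕ}

/-- The span of a family of generators. -/
noncomputable def genSpan (s : Fin n → A) : Submodule ℂ A := Submodule.span ℂ (Set.range s)

/-- The span of the adjoints of a family of generators. -/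
noncomputable def adjSpan (s : Fin n → A) : Submodule ℂ A :=
  Submodule.span ℂ (Set.range fun i => star (s i))

/-- The span of the products `s_μ s_ν^*` of words with `|μ| = e` and `|ν| = e'`. -/
noncomputable def wordSpan (s : Fin n → A) (e e' : ℕ) : Submodule ℂ A :=
  genSpan s ^ e * adjSpan s ^ e'

variable {s : Fin n → A}

theorem mem_genSpan (i : Fin n) : s i ∈ genSpan s := Submodule.subset_span ⟨i, rfl⟩

theorem star_mem_adjSpan (i : Fin n) : star (s i) ∈ adjSpan s := Submodule.subset_span ⟨i, rfl⟩

theorem star_mem_adjSpan_of_mem : ∀ x ∈ genSpan s, star x ∈ adjSpan s := by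
  intro x hx
  induction hx using Submodule.span_induction with
  | mem x h => obtain ⟨i, rfl⟩ := h; exact star_mem_adjSpan i
  | zero => simp
  | add x y _ _ hx hy => simpa using add_mem hx hy
  | smul c x _ hx => rw [star_smul]; exact Submodule.smul_mem _ _ hx

theorem star_mem_genSpan_of_mem : ∀ x ∈ adjSpan s, star x ∈ genSpan s := by
  intro x hx
  induction hx using Submodule.span_induction with
  | mem x h => obtain ⟨i, rfl⟩ := h; simpa using mem_genSpan i
  | zero => simp
  | add x y _ _ hx hy => simpa using add_mem hx hy
  | smul c x _ hx => rw [star_smul]; exact Submodule.smul_mem _ _ hx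

theorem star_mem_wordSpan {e e' : ℕ} : ∀ x ∈ wordSpan s e e', star x ∈ wordSpan s e' e :=
  Submodule.star_mem_mul (Submodule.star_mem_pow star_mem_adjSpan_of_mem e)
    (Submodule.star_mem_pow star_mem_genSpan_of_mem e')

namespace IsCuntzFamily

variable (hs : IsCuntzFamily s)
include hs

theorem adjSpan_mul_genSpan_le : adjSpan s * genSpan s ≤ 1 := by
  rw [adjSpan, genSpan, Submodule.span_mul_span, Submodule.span_le]
  rintro _ ⟨_, ⟨i, rfl⟩, _, ⟨j, rfl⟩, rfl⟩
  simp only [hs.orthogonal, SetLike.mem_coe]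
  split_ifs
  · exact Submodule.one_le.1 le_rfl
  · exact zero_mem _

theorem wordSpan_mul_wordSpan_le (e e' h h' : ℕ) :
    wordSpan s e e' * wordSpan s h h' ≤ wordSpan s (e + (h - e')) (h' + (e' - h)) := by
  calc _ = genSpan s ^ e * (adjSpan s ^ e' * genSpan s ^ h) * adjSpan s ^ h' := by
        simp only [wordSpan, mul_assoc]
    _ ≤ genSpan s ^ e * (genSpan s ^ (h - e') * adjSpan s ^ (e' - h)) * adjSpan s ^ h' := by
        refine mul_le_mul' (mul_le_mul' le_rfl ?_) le_rfl
        exact Submodule.pow_mul_pow_le_of_mul_le_one hs.adjSpan_mul_genSpan_le _ _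
    _ = _ := by
        rw [wordSpan, pow_add, add_comm h', pow_add]
        simp only [mul_assoc]

theorem exists_words (d : ℕ) : ∃ (N : ℕ) (w : Fin N → A),
    (∀ a, w a ∈ genSpan s ^ d) ∧ IsCuntzFamily w := by
  induction d with
  | zero =>
    refine ⟨1, fun _ => 1, fun a => ?_, fun a b => ?_, by simp⟩
    · rw [pow_zero]; exact Submodule.one_le.1 le_rfl
    · simp [Subsingleton.elim a b]
  | succ d ih =>
    obtain ⟨N, w, hw, hc⟩ := ih
    refine ⟨N * n, _, fun a => ?_, (hc.mul hs).comp_equiv finProdFinEquiv.symm⟩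
    rw [pow_succ]
    exact Submodule.mul_mem_mul (hw _) (mem_genSpan _)

/-- Compression by the isometry `s_i^d` turns every balanced word of length at most `d` into a
scalar. -/
theorem conj_pow_wordSpan_le (i : Fin n) {d e : ℕ} (he : e ≤ d) :
    (ℂ ∙ star (s i)) ^ d * wordSpan s e e * (ℂ ∙ s i) ^ d ≤ 1 := by
  have hP : (ℂ ∙ star (s i)) ≤ adjSpan s := by
    rw [Submodule.span_singleton_le_iff_mem]; exact star_mem_adjSpan i
  have hQ : (ℂ ∙ s i) ≤ genSpan s := by
    rw [Submodule.span_singleton_le_iff_mem]; exact mem_genSpan i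
  calc _ ≤ adjSpan s ^ d * wordSpan s e e * genSpan s ^ d := by gcongr
    _ = (adjSpan s ^ d * genSpan s ^ e) * (adjSpan s ^ e * genSpan s ^ d) := by
        simp only [wordSpan, mul_assoc]
    _ ≤ (genSpan s ^ (e - d) * adjSpan s ^ (d - e)) * (genSpan s ^ (d - e) * adjSpan s ^ (e - d)) :=
        mul_le_mul'
          (Submodule.pow_mul_pow_le_of_mul_le_one hs.adjSpan_mul_genSpan_le _ _)
          (Submodule.pow_mul_pow_le_of_mul_le_one hs.adjSpan_mul_genSpan_le _ _)
    _ ≤ 1 := by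
        rw [Nat.sub_eq_zero_of_le he]
        simpa using Submodule.pow_mul_pow_le_of_mul_le_one hs.adjSpan_mul_genSpan_le (d - e) (d - e)

/-- Compression by the isometry `s_i^d s_j` turns every word of lengths at most `d` into a scalar,
which vanishes unless the word is balanced. -/
theorem conj_wordSpan_le {i j : Fin n} (hij : i ≠ j) {d e e' : ℕ} (he : e ≤ d) (he' : e' ≤ d) :
    (ℂ ∙ star (s j)) * (ℂ ∙ star (s i)) ^ d * wordSpan s e e' * ((ℂ ∙ s i) ^ d * (ℂ ∙ s j)) ≤
      if e = e' then 1 else ⊥ := by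
  have hP : ∀ k, (ℂ ∙ star (s k)) ≤ adjSpan s := fun k => by
    rw [Submodule.span_singleton_le_iff_mem]; exact star_mem_adjSpan k
  have hQ : ∀ k, (ℂ ∙ s k) ≤ genSpan s := fun k => by
    rw [Submodule.span_singleton_le_iff_mem]; exact mem_genSpan k
  have hRL := hs.adjSpan_mul_genSpan_le
  have h1 : (ℂ ∙ star (s i)) ^ d * genSpan s ^ e ≤ (ℂ ∙ star (s i)) ^ (d - e) := by
    have := Submodule.pow_mul_pow_le_of_mul_le_one
      ((mul_le_mul' (hP i) le_rfl).trans hRL : (ℂ ∙ star (s i)) * genSpan s ≤ 1) d e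
    simpa [Nat.sub_eq_zero_of_le he] using this
  have h2 : adjSpan s ^ e' * (ℂ ∙ s i) ^ d ≤ (ℂ ∙ s i) ^ (d - e') := by
    have := Submodule.pow_mul_pow_le_of_mul_le_one
      ((mul_le_mul' le_rfl (hQ i)).trans hRL : adjSpan s * (ℂ ∙ s i) ≤ 1) e' d
    simpa [Nat.sub_eq_zero_of_le he'] using this
  have h3 := Submodule.pow_mul_pow_le_of_mul_le_one
    ((mul_le_mul' (hP i) (hQ i)).trans hRL) (d - e) (d - e')
  have h4 : (ℂ ∙ star (s i)) * (ℂ ∙ s j) = ⊥ := by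
    rw [Submodule.span_mul_span, Set.singleton_mul_singleton, hs.orthogonal, if_neg hij,
      Submodule.span_zero_singleton]
  have h5 : (ℂ ∙ star (s j)) * (ℂ ∙ s i) = ⊥ := by
    rw [Submodule.span_mul_span, Set.singleton_mul_singleton, hs.orthogonal, if_neg hij.symm,
      Submodule.span_zero_singleton]
  calc _ = (ℂ ∙ star (s j)) * ((ℂ ∙ star (s i)) ^ d * genSpan s ^ e) *
        (adjSpan s ^ e' * (ℂ ∙ s i) ^ d) * (ℂ ∙ s j) := by
        simp only [wordSpan, mul_assoc]
    _ ≤ (ℂ ∙ star (s j)) * (ℂ ∙ star (s i)) ^ (d - e) * (ℂ ∙ s i) ^ (d - e') * (ℂ ∙ s j) := by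
        gcongr
    _ = (ℂ ∙ star (s j)) * ((ℂ ∙ star (s i)) ^ (d - e) * (ℂ ∙ s i) ^ (d - e')) * (ℂ ∙ s j) := by
        simp only [mul_assoc]
    _ ≤ (ℂ ∙ star (s j)) * ((ℂ ∙ s i) ^ (d - e' - (d - e)) *
          (ℂ ∙ star (s i)) ^ (d - e - (d - e'))) * (ℂ ∙ s j) := by
        gcongr
    _ ≤ _ := by
        rcases lt_trichotomy e e' with h | h | h
        · obtain ⟨k, hk⟩ : ∃ k, d - e - (d - e') = k + 1 := ⟨d - e - (d - e') - 1, by omega⟩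
          rw [if_neg h.ne, hk, pow_succ]
          simp only [mul_assoc, h4, Submodule.mul_bot, le_refl]
        · subst h
          simpa using (mul_le_mul' (hP j) (hQ j)).trans hRL
        · obtain ⟨k, hk⟩ : ∃ k, d - e' - (d - e) = k + 1 := ⟨d - e' - (d - e) - 1, by omega⟩
          rw [if_neg h.ne', hk, pow_succ']
          simp only [← mul_assoc, h5, Submodule.bot_mul, le_refl]

end IsCuntzFamily

/-- Elements of `U` and `V` commute up to a common nonzero scalar. -/
def TwistComm (U V : Submodule ℂ A) : Prop :=
  ∃ c : ℂ, c ≠ 0 ∧ ∀ u ∈ U, ∀ v ∈ V, u * v = c • (v * u)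

theorem TwistComm.mono {U V U' V' : Submodule ℂ A} (h : TwistComm U V) (hU : U' ≤ U)
    (hV : V' ≤ V) : TwistComm U' V' := by
  obtain ⟨c, hc, h⟩ := h
  exact ⟨c, hc, fun u hu v hv => h u (hU hu) v (hV hv)⟩

theorem TwistComm.commute {U V : Submodule ℂ A} (h : TwistComm U V) : Commute U V := by
  obtain ⟨c, hc, h⟩ := h
  apply le_antisymm <;> rw [Submodule.mul_le]
  · intro u hu v hv
    rw [h u hu v hv]
    exact Submodule.smul_mem _ _ (Submodule.mul_mem_mul hv hu)
  · intro v hv u hu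
    rw [← inv_smul_smul₀ hc (v * u), ← h u hu v hv]
    exact Submodule.smul_mem _ _ (Submodule.mul_mem_mul hu hv)

theorem TwistComm.of_span {S T : Set A} {c : ℂ} (hc : c ≠ 0)
    (h : ∀ u ∈ S, ∀ v ∈ T, u * v = c • (v * u)) :
    TwistComm (Submodule.span ℂ S) (Submodule.span ℂ T) := by
  refine ⟨c, hc, fun u hu v hv => ?_⟩
  induction hu, hv using Submodule.span_induction₂ with
  | mem_mem x y hx hy => exact h x hx y hy
  | zero_left y hy => simp
  | zero_right x hx => simp
  | add_left x y z _ _ _ hx hy => simp [add_mul, mul_add, hx, hy]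
  | add_right x y z _ _ _ hx hy => simp [add_mul, mul_add, hx, hy]
  | smul_left r x y _ _ h => simp [h, smul_comm c]
  | smul_right r x y _ _ h => simp [h, smul_comm c]

end Words

/-! ### Pairs of twisted-commuting Cuntz families -/

section Pair

variable {A : Type*} [CStarAlgebra A] {n m : ℕ}

/-- Two Cuntz families with `s_j^* t_r = q t_r s_j^*` that generate the C⋆-algebra. -/
structure IsQCuntzPair (q : ℂ) (s : Fin n → A) (t : Fin m → A) : Prop where
  ne_zero : q ≠ 0
  left : IsCuntzFamily s
  right : IsCuntzFamily t
  star_s_mul_t : ∀ j r, star (s j) * t r = q • (t r * star (s j))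
  dense : Dense (StarAlgebra.adjoin ℂ (Set.range s ∪ Set.range t) : Set A)

/-- The span of the words `s_μ s_μ'^* t_ν t_ν'^*` with `|μ| = e`, `|μ'| = e'`, `|ν| = f`,
`|ν'| = f'`. -/
noncomputable def biWordSpan (s : Fin n → A) (t : Fin m → A) (e e' f f' : ℕ) : Submodule ℂ A :=
  wordSpan s e e' * wordSpan t f f'

namespace IsQCuntzPair

variable {q : ℂ} {s : Fin n → A} {t : Fin m → A} (h : IsQCuntzPair q s t)
include h

/-- In the presence of `∑ s_j s_j^* = 1`, the relation between `s_j^*` and `t_r` implies the one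
between `s_j` and `t_r`. -/
theorem t_mul_s (j : Fin n) (r : Fin m) : t r * s j = q • (s j * t r) := by
  calc t r * s j = (∑ k, s k * star (s k)) * t r * s j := by rw [h.left.total, one_mul]
    _ = ∑ k, q • (s k * (t r * (star (s k) * s j))) := by
      rw [Finset.sum_mul, Finset.sum_mul]
      refine Finset.sum_congr rfl fun k _ => ?_
      rw [mul_assoc (s k), h.star_s_mul_t]
      simp only [mul_smul_comm, smul_mul_assoc, mul_assoc]
    _ = _ := by simp [h.left.orthogonal]

theorem twistComm_gen_gen : TwistComm (genSpan s) (genSpan t) := by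
  refine TwistComm.of_span (inv_ne_zero h.ne_zero) ?_
  rintro _ ⟨j, rfl⟩ _ ⟨r, rfl⟩
  rw [h.t_mul_s, inv_smul_smul₀ h.ne_zero]

theorem twistComm_adj_gen : TwistComm (adjSpan s) (genSpan t) := by
  refine TwistComm.of_span h.ne_zero ?_
  rintro _ ⟨j, rfl⟩ _ ⟨r, rfl⟩
  exact h.star_s_mul_t j r

theorem twistComm_adj_adj : TwistComm (adjSpan s) (adjSpan t) := by
  refine TwistComm.of_span (star_ne_zero.2 h.ne_zero) ?_
  rintro _ ⟨j, rfl⟩ _ ⟨r, rfl⟩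
  simp only [← star_mul, h.t_mul_s, star_smul]

theorem twistComm_gen_adj : TwistComm (genSpan s) (adjSpan t) := by
  refine TwistComm.of_span (star_ne_zero.2 (inv_ne_zero h.ne_zero)) ?_
  rintro _ ⟨j, rfl⟩ _ ⟨r, rfl⟩
  have : t r * star (s j) = q⁻¹ • (star (s j) * t r) := by
    rw [h.star_s_mul_t, inv_smul_smul₀ h.ne_zero]
  simpa using congrArg star this

theorem commute_wordSpan (e e' f f' : ℕ) : Commute (wordSpan s e e') (wordSpan t f f') :=
  .mul_left
    (.mul_right (h.twistComm_gen_gen.commute.pow_pow _ _) (h.twistComm_gen_adj.commute.pow_pow _ _))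
    (.mul_right (h.twistComm_adj_gen.commute.pow_pow _ _) (h.twistComm_adj_adj.commute.pow_pow _ _))

theorem star_mem_biWordSpan {e e' f f' : ℕ} :
    ∀ x ∈ biWordSpan s t e e' f f', star x ∈ biWordSpan s t e' e f' f := by
  intro x hx
  rw [biWordSpan, (h.commute_wordSpan _ _ _ _).eq]
  exact Submodule.star_mem_mul star_mem_wordSpan star_mem_wordSpan x hx

theorem biWordSpan_mul_le (e e' f f' k k' l l' : ℕ) :
    biWordSpan s t e e' f f' * biWordSpan s t k k' l l' ≤
      biWordSpan s t (e + (k - e')) (k' + (e' - k)) (f + (l - f')) (l' + (f' - l)) := by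
  calc _ = wordSpan s e e' * (wordSpan t f f' * wordSpan s k k') * wordSpan t l l' := by
        simp only [biWordSpan, mul_assoc]
    _ = (wordSpan s e e' * wordSpan s k k') * (wordSpan t f f' * wordSpan t l l') := by
        rw [← (h.commute_wordSpan k k' f f').eq]
        simp only [mul_assoc]
    _ ≤ _ := mul_le_mul' (h.left.wordSpan_mul_wordSpan_le _ _ _ _)
        (h.right.wordSpan_mul_wordSpan_le _ _ _ _)

omit h in
theorem one_mem_biWordSpan : (1 : A) ∈ biWordSpan s t 0 0 0 0 := by
  simp only [biWordSpan, wordSpan, pow_zero, mul_one]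
  exact Submodule.one_le.1 le_rfl

omit h in
theorem s_mem_biWordSpan (j : Fin n) : s j ∈ biWordSpan s t 1 0 0 0 := by
  simpa only [biWordSpan, wordSpan, pow_zero, pow_one, mul_one] using mem_genSpan j

omit h in
theorem t_mem_biWordSpan (r : Fin m) : t r ∈ biWordSpan s t 0 0 1 0 := by
  simpa only [biWordSpan, wordSpan, pow_zero, pow_one, mul_one, one_mul] using mem_genSpan r

/-- A property of elements of the algebra that holds on all words, is stable under addition and is
closed holds everywhere. -/
theorem induction_words {p : A → Prop} (hword : ∀ e e' f f', ∀ x ∈ biWordSpan s t e e' f f', p x)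
    (hadd : ∀ x y, p x → p y → p (x + y)) (hclosed : ∀ x, (∀ ε : ℝ, 0 < ε → ∃ y, p y ∧
      ‖x - y‖ < ε) → p x) (x : A) : p x := by
  let W : Submodule ℂ A := ⨆ i : ℕ × ℕ × ℕ × ℕ, biWordSpan s t i.1 i.2.1 i.2.2.1 i.2.2.2
  have hle : ∀ e e' f f', biWordSpan s t e e' f f' ≤ W := fun e e' f f' =>
    le_iSup (fun i : ℕ × ℕ × ℕ × ℕ => biWordSpan s t i.1 i.2.1 i.2.2.1 i.2.2.2) (e, e', f, f')
  have hmul : W * W ≤ W := by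
    simp only [W, Submodule.iSup_mul, Submodule.mul_iSup, iSup_le_iff]
    intro i j
    exact (h.biWordSpan_mul_le _ _ _ _ _ _ _ _).trans (hle _ _ _ _)
  have hstar : ∀ x ∈ W, star x ∈ W := by
    intro x hx
    induction hx using Submodule.iSup_induction' with
    | mem i x hx => exact hle _ _ _ _ (h.star_mem_biWordSpan x hx)
    | zero => simp
    | add x y _ _ hx hy => simpa using add_mem hx hy
  have hone : (1 : A) ∈ W := hle _ _ _ _ one_mem_biWordSpan
  let W' : StarSubalgebra ℂ A :=
    { carrier := W
      mul_mem' := fun ha hb => hmul (Submodule.mul_mem_mul ha hb)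
      add_mem' := fun ha hb => W.add_mem ha hb
      algebraMap_mem' := fun c => by
        rw [Algebra.algebraMap_eq_smul_one]; exact W.smul_mem c hone
      star_mem' := fun ha => hstar _ ha }
  have hadj : StarAlgebra.adjoin ℂ (Set.range s ∪ Set.range t) ≤ W' := by
    refine StarAlgebra.adjoin_le ?_
    rintro _ (⟨j, rfl⟩ | ⟨r, rfl⟩)
    · exact hle _ _ _ _ (s_mem_biWordSpan j)
    · exact hle _ _ _ _ (t_mem_biWordSpan r)
  have hW : ∀ y ∈ W, p y := by
    intro y hy
    induction hy using Submodule.iSup_induction' with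
    | mem i x hx => exact hword _ _ _ _ x hx
    | zero => exact hword 0 0 0 0 0 (zero_mem _)
    | add x y _ _ hx hy => exact hadd x y hx hy
  refine hclosed x fun ε hε => ?_
  obtain ⟨y, hy, hxy⟩ := Metric.dense_iff.1 h.dense x ε hε
  exact ⟨y, hW y (hadj hxy), by rwa [Metric.mem_ball, dist_comm, dist_eq_norm] at hy⟩

end IsQCuntzPair

end Pair

/-! ### The balanced state -/

section State

open Filter Topology

variable {A : Type*} [CStarAlgebra A] {n m : ℕ}

theorem norm_conj_isometry_le [Nontrivial A] {z : A} (hz : star z * z = 1) (x : A) :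
    ‖star z * x * z‖ ≤ ‖x‖ := by
  have h1 : ‖z‖ ≤ 1 := norm_le_one_of_star_mul_self hz
  calc ‖star z * x * z‖ ≤ ‖star z‖ * ‖x‖ * ‖z‖ :=
        (norm_mul_le _ _).trans (by gcongr; exact norm_mul_le _ _)
    _ ≤ 1 * ‖x‖ * 1 := by rw [norm_star]; gcongr
    _ = ‖x‖ := by ring

theorem isClosed_span_one : IsClosed ((ℂ ∙ (1 : A) : Submodule ℂ A) : Set A) :=
  Submodule.closed_of_finiteDimensional _

/-- If the compressions of `x` by the isometries `z d` are eventually close to scalars, then they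
converge to a scalar. -/
theorem exists_tendsto_conj {z : ℕ → A} {x : A}
    (hx : ∀ ε : ℝ, 0 < ε → ∃ c : ℂ, ∀ᶠ d in atTop, ‖star (z d) * x * z d - c • (1 : A)‖ < ε) :
    ∃ c : ℂ, Tendsto (fun d => star (z d) * x * z d) atTop (𝓝 (c • (1 : A))) := by
  have hc : CauchySeq fun d => star (z d) * x * z d := by
    rw [Metric.cauchySeq_iff']
    intro ε hε
    obtain ⟨c, hc⟩ := hx (ε / 2) (half_pos hε)
    obtain ⟨N, hN⟩ := eventually_atTop.1 hc
    refine ⟨N, fun d hd => ?_⟩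
    calc _ ≤ dist _ (c • (1 : A)) + dist (c • (1 : A)) _ := dist_triangle _ _ _
      _ < ε / 2 + ε / 2 := by
        rw [dist_comm (c • (1 : A))]
        simp only [dist_eq_norm]
        exact add_lt_add (hN d hd) (hN N le_rfl)
      _ = ε := add_halves ε
  obtain ⟨L, hL⟩ := cauchySeq_tendsto_of_complete hc
  have hmem : L ∈ ((ℂ ∙ (1 : A) : Submodule ℂ A) : Set A) := by
    rw [← isClosed_span_one.closure_eq, Metric.mem_closure_iff]
    intro ε hε
    obtain ⟨c, hc⟩ := hx (ε / 2) (half_pos hε)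
    obtain ⟨d, h1, h2⟩ := (hc.and (Metric.tendsto_nhds.1 hL (ε / 2) (half_pos hε))).exists
    refine ⟨c • 1, Submodule.smul_mem _ _ (Submodule.mem_span_singleton_self _), ?_⟩
    calc dist L (c • 1) ≤ dist L (star (z d) * x * z d) + dist (star (z d) * x * z d) (c • 1) :=
          dist_triangle _ _ _
      _ < ε / 2 + ε / 2 := by
        rw [dist_comm L, dist_eq_norm _ (c • (1 : A))]
        exact add_lt_add h2 h1
      _ = ε := add_halves ε
  obtain ⟨c, rfl⟩ := Submodule.mem_span_singleton.1 hmem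
  exact ⟨c, hL⟩

/-- A linear functional that is the limit of the compressions by a sequence of isometries. -/
structure IsConjLimit (z : ℕ → A) (ω : A →ₗ[ℂ] ℂ) : Prop where
  isometry : ∀ d, star (z d) * z d = 1
  tendsto : ∀ x, Tendsto (fun d => star (z d) * x * z d) atTop (𝓝 (ω x • (1 : A)))

variable [Nontrivial A]

theorem smul_one_injective : Function.Injective fun c : ℂ => c • (1 : A) :=
  smul_left_injective ℂ one_ne_zero

theorem exists_isConjLimit {z : ℕ → A} (hz : ∀ d, star (z d) * z d = 1)
    (hx : ∀ x, ∃ c : ℂ, Tendsto (fun d => star (z d) * x * z d) atTop (𝓝 (c • (1 : A)))) :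
    ∃ ω, IsConjLimit z ω := by
  choose f hf using hx
  refine ⟨{ toFun := f, map_add' := fun x y => ?_, map_smul' := fun c x => ?_ }, hz, hf⟩
  · apply smul_one_injective (A := A)
    refine tendsto_nhds_unique (hf (x + y)) ?_
    simpa only [add_smul, mul_add, add_mul] using (hf x).add (hf y)
  · apply smul_one_injective (A := A)
    refine tendsto_nhds_unique (hf (c • x)) ?_
    simpa only [smul_eq_mul, RingHom.id_apply, mul_smul, mul_smul_comm, smul_mul_assoc] using
      (hf x).const_smul c

namespace IsConjLimit

variable {z : ℕ → A} {ω : A →ₗ[ℂ] ℂ} (h : IsConjLimit z ω)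
include h

theorem eq_of_eventually {x : A} {c : ℂ}
    (hc : ∀ᶠ d in atTop, star (z d) * x * z d = c • (1 : A)) : ω x = c :=
  smul_one_injective (A := A) (tendsto_nhds_unique (h.tendsto x)
    (tendsto_const_nhds.congr' (hc.mono fun _ hd => hd.symm)))

theorem map_one' : ω 1 = 1 :=
  h.eq_of_eventually (.of_forall fun d => by rw [mul_one, h.isometry, one_smul])

theorem isState [PartialOrder A] [StarOrderedRing A] : IsState ω where
  map_one := h.map_one'
  map_star x := by
    apply smul_one_injective (A := A)
    refine tendsto_nhds_unique (h.tendsto (star x)) ?_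
    have := (h.tendsto x).star
    simpa only [star_mul, star_star, star_smul, star_one, mul_assoc] using this
  nonneg x := by
    have h1 : 0 ≤ ω (star x * x) • (1 : A) := by
      refine ge_of_tendsto (h.tendsto _) (.of_forall fun d => ?_)
      have : star (z d) * (star x * x) * z d = star (x * z d) * (x * z d) := by
        simp only [star_mul, mul_assoc]
      rw [this]
      exact star_mul_self_nonneg _
    rw [← Algebra.algebraMap_eq_smul_one] at h1
    exact spectrum_nonneg_of_nonneg h1 (by rw [spectrum.scalar_eq]; rfl)

omit [Nontrivial A] in
/-- If `ω` does not vanish at `x`, then some compression of `x` is invertible. -/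
theorem exists_isUnit {x : A} (hx : ω x ≠ 0) : ∃ d, IsUnit (star (z d) * x * z d) := by
  have hu : IsUnit (ω x • (1 : A)) := by
    rw [← Algebra.algebraMap_eq_smul_one]
    exact (IsUnit.mk0 _ hx).map (algebraMap ℂ A)
  exact ((h.tendsto x).eventually (Units.isOpen.mem_nhds hu)).exists

/-- A case of the Cauchy-Schwarz inequality for `ω`. -/
theorem norm_sq_le {w x : A} (hw : star w * w = 1) : ‖ω (star w * x)‖ ^ 2 ≤ ‖ω (star x * x)‖ := by
  have hn : ∀ c : ℂ, ‖c • (1 : A)‖ = ‖c‖ := fun c => by rw [norm_smul, norm_one, mul_one]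
  rw [← hn, ← hn]
  refine le_of_tendsto_of_tendsto ((h.tendsto _).norm.pow 2) (h.tendsto _).norm
    (.of_forall fun d => ?_)
  have h1 : ‖star (z d) * (star w * x) * z d‖ ≤ ‖x * z d‖ := by
    have hz := norm_le_one_of_star_mul_self (h.isometry d)
    have hw' := norm_le_one_of_star_mul_self hw
    calc _ = ‖star (z d) * star w * (x * z d)‖ := by simp only [mul_assoc]
      _ ≤ ‖star (z d)‖ * ‖star w‖ * ‖x * z d‖ :=
        (norm_mul_le _ _).trans (by gcongr; exact norm_mul_le _ _)
      _ ≤ 1 * 1 * ‖x * z d‖ := by rw [norm_star, norm_star]; gcongr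
      _ = _ := by ring
  calc _ ≤ ‖x * z d‖ ^ 2 := pow_le_pow_left₀ (norm_nonneg _) h1 2
    _ = ‖star (x * z d) * (x * z d)‖ := by rw [CStarRing.norm_star_mul_self, sq]
    _ = _ := by simp only [star_mul, mul_assoc]

end IsConjLimit

namespace IsQCuntzPair

variable {q : ℂ} {s : Fin n → A} {t : Fin m → A} (h : IsQCuntzPair q s t)
include h

omit [Nontrivial A] h in
/-- Compressions of words in both families factor into compressions of words in each family. -/
theorem conj_biWordSpan_le {U' U V' V a b : Submodule ℂ A} {e e' f f' : ℕ} (h1 : Commute U' V')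
    (h2 : Commute (wordSpan s e e') V') (h3 : Commute U V') (h4 : Commute U (wordSpan t f f'))
    (ha : U' * wordSpan s e e' * U ≤ a) (hb : V' * wordSpan t f f' * V ≤ b) :
    (V' * U') * biWordSpan s t e e' f f' * (U * V) ≤ a * b :=
  calc _ = V' * (U' * wordSpan s e e') * (wordSpan t f f' * U) * V := by
        simp only [biWordSpan, mul_assoc]
    _ = V' * (U' * wordSpan s e e' * U) * (wordSpan t f f' * V) := by
        rw [← h4.eq]; simp only [mul_assoc]
    _ = (U' * wordSpan s e e' * U) * (V' * wordSpan t f f' * V) := by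
        rw [← ((h1.mul_left h2).mul_left h3).eq]; simp only [mul_assoc]
    _ ≤ _ := mul_le_mul' ha hb

omit [Nontrivial A]

theorem twistComm_star_s_adj (i : Fin n) : TwistComm (ℂ ∙ star (s i)) (adjSpan t) :=
  h.twistComm_adj_adj.mono ((Submodule.span_singleton_le_iff_mem _ _).2 (star_mem_adjSpan i)) le_rfl

theorem twistComm_s_adj (i : Fin n) : TwistComm (ℂ ∙ s i) (adjSpan t) :=
  h.twistComm_gen_adj.mono ((Submodule.span_singleton_le_iff_mem _ _).2 (mem_genSpan i)) le_rfl

theorem twistComm_s_gen (i : Fin n) : TwistComm (ℂ ∙ s i) (genSpan t) :=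
  h.twistComm_gen_gen.mono ((Submodule.span_singleton_le_iff_mem _ _).2 (mem_genSpan i)) le_rfl

theorem commute_s_wordSpan (i : Fin n) (f f' : ℕ) : Commute (ℂ ∙ s i) (wordSpan t f f') :=
  Commute.mul_right ((h.twistComm_s_gen i).commute.pow_right _)
    ((h.twistComm_s_adj i).commute.pow_right _)

theorem commute_wordSpan_star_t (e e' : ℕ) (k : Fin m) :
    Commute (wordSpan s e e') (ℂ ∙ star (t k)) :=
  have hk := (Submodule.span_singleton_le_iff_mem _ _).2 (star_mem_adjSpan (s := t) k)
  Commute.mul_left ((h.twistComm_gen_adj.mono le_rfl hk).commute.pow_left _)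
    ((h.twistComm_adj_adj.mono le_rfl hk).commute.pow_left _)

theorem commute_star_s_star_t (i : Fin n) (k : Fin m) :
    Commute (ℂ ∙ star (s i)) (ℂ ∙ star (t k)) :=
  ((h.twistComm_star_s_adj i).mono le_rfl
    ((Submodule.span_singleton_le_iff_mem _ _).2 (star_mem_adjSpan k))).commute

theorem commute_s_star_t (i : Fin n) (k : Fin m) : Commute (ℂ ∙ s i) (ℂ ∙ star (t k)) :=
  ((h.twistComm_s_adj i).mono le_rfl
    ((Submodule.span_singleton_le_iff_mem _ _).2 (star_mem_adjSpan k))).commute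

theorem commute_s_t (i : Fin n) (k : Fin m) : Commute (ℂ ∙ s i) (ℂ ∙ t k) :=
  ((h.twistComm_s_gen i).mono le_rfl
    ((Submodule.span_singleton_le_iff_mem _ _).2 (mem_genSpan k))).commute

theorem conj_biWordSpan_le_ite {i j : Fin n} (hij : i ≠ j) {k l : Fin m} (hkl : k ≠ l)
    {d e e' f f' : ℕ} (he : e ≤ d) (he' : e' ≤ d) (hf : f ≤ d) (hf' : f' ≤ d) :
    ((ℂ ∙ star (t l)) * (ℂ ∙ star (t k)) ^ d * ((ℂ ∙ star (s j)) * (ℂ ∙ star (s i)) ^ d)) *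
      biWordSpan s t e e' f f' * ((ℂ ∙ s i) ^ d * (ℂ ∙ s j) * ((ℂ ∙ t k) ^ d * (ℂ ∙ t l))) ≤
      (if e = e' then 1 else ⊥) * (if f = f' then 1 else ⊥) := by
  have hPP := h.commute_star_s_star_t
  have hQP := h.commute_s_star_t
  have hwP := h.commute_wordSpan_star_t e e'
  have hQw := fun i => h.commute_s_wordSpan i f f'
  refine conj_biWordSpan_le ?_ ?_ ?_ ?_
      (h.left.conj_wordSpan_le hij he he') (h.right.conj_wordSpan_le hkl hf hf')
  · exact ((hPP j l).mul_right ((hPP j k).pow_right d)).mul_left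
      (((hPP i l).pow_left d).mul_right ((hPP i k).pow_pow d d))
  · exact (hwP l).mul_right ((hwP k).pow_right d)
  · exact (((hQP i l).pow_left d).mul_right ((hQP i k).pow_pow d d)).mul_left
      ((hQP j l).mul_right ((hQP j k).pow_right d))
  · exact ((hQw i).pow_left d).mul_left (hQw j)

theorem conj_pow_biWordSpan_le (i : Fin n) (k : Fin m) {d e f : ℕ} (he : e ≤ d) (hf : f ≤ d) :
    ((ℂ ∙ star (t k)) ^ d * (ℂ ∙ star (s i)) ^ d) *
      biWordSpan s t e e f f * ((ℂ ∙ s i) ^ d * (ℂ ∙ t k) ^ d) ≤ 1 * 1 :=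
  conj_biWordSpan_le ((h.commute_star_s_star_t i k).pow_pow d d)
    ((h.commute_wordSpan_star_t e e k).pow_right d) ((h.commute_s_star_t i k).pow_pow d d)
    ((h.commute_s_wordSpan i f f).pow_left d) (h.left.conj_pow_wordSpan_le i he)
    (h.right.conj_pow_wordSpan_le k hf)

theorem pow_mul_mem (i : Fin n) (k : Fin m) (d : ℕ) :
    (s i * t k) ^ d ∈ (ℂ ∙ s i) ^ d * (ℂ ∙ t k) ^ d := by
  rw [← (h.commute_s_t i k).mul_pow]
  exact Submodule.pow_mem_pow _ (Submodule.mul_mem_mul (Submodule.mem_span_singleton_self _)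
    (Submodule.mem_span_singleton_self _)) d

theorem star_pow_mul_mem (i : Fin n) (k : Fin m) (d : ℕ) :
    star ((s i * t k) ^ d) ∈ (ℂ ∙ star (t k)) ^ d * (ℂ ∙ star (s i)) ^ d := by
  rw [← (h.commute_star_s_star_t i k).symm.mul_pow, star_pow, star_mul]
  exact Submodule.pow_mem_pow _ (Submodule.mul_mem_mul (Submodule.mem_span_singleton_self _)
    (Submodule.mem_span_singleton_self _)) d

/-- The isometries `(s_i t_k)^d s_j t_l` compress unbalanced words of lengths at most `d` to
zero. -/
theorem conj_eq_zero {i j : Fin n} (hij : i ≠ j) {k l : Fin m} (hkl : k ≠ l)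
    {d e e' f f' : ℕ} (he : e ≤ d) (he' : e' ≤ d) (hf : f ≤ d) (hf' : f' ≤ d)
    (hne : ¬ (e = e' ∧ f = f')) {x : A} (hx : x ∈ biWordSpan s t e e' f f') :
    star ((s i * t k) ^ d * (s j * t l)) * x * ((s i * t k) ^ d * (s j * t l)) = 0 := by
  have hself : ∀ x : A, x ∈ (ℂ ∙ x) := Submodule.mem_span_singleton_self
  have hz : (s i * t k) ^ d * (s j * t l) ∈
      (ℂ ∙ s i) ^ d * (ℂ ∙ s j) * ((ℂ ∙ t k) ^ d * (ℂ ∙ t l)) := by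
    have : (ℂ ∙ s i) ^ d * (ℂ ∙ s j) * ((ℂ ∙ t k) ^ d * (ℂ ∙ t l)) =
        (ℂ ∙ s i) ^ d * (ℂ ∙ t k) ^ d * ((ℂ ∙ s j) * (ℂ ∙ t l)) :=
      ((h.commute_s_t j k).pow_right d).mul_mul_mul_comm _ _
    rw [this]
    exact Submodule.mul_mem_mul (h.pow_mul_mem i k d)
      (Submodule.mul_mem_mul (hself _) (hself _))
  have hz' : star ((s i * t k) ^ d * (s j * t l)) ∈
      (ℂ ∙ star (t l)) * (ℂ ∙ star (t k)) ^ d * ((ℂ ∙ star (s j)) * (ℂ ∙ star (s i)) ^ d) := by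
    have : (ℂ ∙ star (t l)) * (ℂ ∙ star (t k)) ^ d * ((ℂ ∙ star (s j)) * (ℂ ∙ star (s i)) ^ d) =
        (ℂ ∙ star (t l)) * (ℂ ∙ star (s j)) * ((ℂ ∙ star (t k)) ^ d * (ℂ ∙ star (s i)) ^ d) :=
      ((h.commute_star_s_star_t j k).symm.pow_left d).mul_mul_mul_comm _ _
    rw [this, star_mul, star_mul (s j)]
    exact Submodule.mul_mem_mul (Submodule.mul_mem_mul (hself _) (hself _))
      (h.star_pow_mul_mem i k d)
  have hm := h.conj_biWordSpan_le_ite hij hkl he he' hf hf'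
    (Submodule.mul_mem_mul (Submodule.mul_mem_mul hz' hx) hz)
  have h0 : ((if e = e' then 1 else ⊥) * (if f = f' then 1 else ⊥) : Submodule ℂ A) = ⊥ := by
    by_cases h1 : e = e'
    · rw [if_neg fun h2 => hne ⟨h1, h2⟩, Submodule.mul_bot]
    · rw [if_neg h1, Submodule.bot_mul]
  rwa [h0, Submodule.mem_bot] at hm

/-- The isometry `(s_i t_k)^d` compresses balanced words of lengths at most `d` to scalars. -/
theorem exists_conj_pow_eq (i : Fin n) (k : Fin m) {d e f : ℕ} (he : e ≤ d) (hf : f ≤ d) {x : A}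
    (hx : x ∈ biWordSpan s t e e f f) :
    ∃ c : ℂ, star ((s i * t k) ^ d) * x * (s i * t k) ^ d = c • (1 : A) := by
  have hm := h.conj_pow_biWordSpan_le i k he hf (Submodule.mul_mem_mul
    (Submodule.mul_mem_mul (h.star_pow_mul_mem i k d) hx) (h.pow_mul_mem i k d))
  rw [mul_one, Submodule.mem_one] at hm
  obtain ⟨c, hc⟩ := hm
  exact ⟨c, by rw [← hc, Algebra.algebraMap_eq_smul_one]⟩

/-- There is a state that vanishes on all unbalanced words and is the limit of compressions by
isometries. -/
theorem exists_balanced_state [Nontrivial A] {i j : Fin n} (hij : i ≠ j) {k l : Fin m}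
    (hkl : k ≠ l) : ∃ (z : ℕ → A) (ω : A →ₗ[ℂ] ℂ), IsConjLimit z ω ∧
      ∀ e e' f f', ¬ (e = e' ∧ f = f') → ∀ x ∈ biWordSpan s t e e' f f', ω x = 0 := by
  let v : A := s i * t k
  let u : A := s j * t l
  let z (d : ℕ) : A := v ^ d * u
  have hiso : ∀ a b, star (s a * t b) * (s a * t b) = 1 := fun a b => by
    rw [star_mul, mul_assoc, ← mul_assoc (star (s a)), h.left.orthogonal, if_pos rfl, one_mul,
      h.right.orthogonal, if_pos rfl]
  have hz : ∀ d, star (z d) * z d = 1 := by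
    intro d
    induction d with
    | zero =>
      rw [show z 0 = u by simp [z]]
      exact hiso j l
    | succ d ih =>
      have : z (d + 1) = v * z d := by simp only [z, pow_succ', mul_assoc]
      rw [this, star_mul, mul_assoc, ← mul_assoc (star v), hiso, one_mul, ih]
  have hunbal : ∀ e e' f f', ¬ (e = e' ∧ f = f') → ∀ x ∈ biWordSpan s t e e' f f',
      ∀ᶠ d in atTop, star (z d) * x * z d = (0 : ℂ) • (1 : A) := by
    intro e e' f f' hne x hx
    filter_upwards [eventually_ge_atTop e, eventually_ge_atTop e', eventually_ge_atTop f,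
      eventually_ge_atTop f'] with d he he' hf hf'
    rw [zero_smul]
    exact h.conj_eq_zero hij hkl he he' hf hf' hne hx
  have hword : ∀ e e' f f', ∀ x ∈ biWordSpan s t e e' f f', ∃ c : ℂ,
      ∀ᶠ d in atTop, star (z d) * x * z d = c • (1 : A) := by
    intro e e' f f' x hx
    by_cases hne : e = e' ∧ f = f'
    · obtain ⟨rfl, rfl⟩ := hne
      -- The compression by `v ^ D` is already a scalar, and `z d = v ^ D * z (d - D)`.
      let D := max e f
      obtain ⟨c, hc⟩ := h.exists_conj_pow_eq i k (le_max_left e f) (le_max_right e f) hx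
      refine ⟨c, (eventually_ge_atTop D).mono fun d hd => ?_⟩
      obtain ⟨d, rfl⟩ := Nat.exists_eq_add_of_le hd
      have : z (D + d) = v ^ D * z d := by simp only [z, pow_add, mul_assoc]
      calc _ = star (z d) * (star (v ^ D) * x * v ^ D) * z d := by
            rw [this, star_mul]; simp only [mul_assoc]
        _ = c • (1 : A) := by
            rw [hc, mul_smul_comm, mul_one, smul_mul_assoc, hz]
    · exact ⟨0, hunbal e e' f f' hne x hx⟩
  obtain ⟨ω, hω⟩ := exists_isConjLimit hz fun x => exists_tendsto_conj fun ε hε => by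
    induction x using h.induction_words generalizing ε with
    | hword e e' f f' x hx =>
      obtain ⟨c, hc⟩ := hword e e' f f' x hx
      exact ⟨c, hc.mono fun d hd => by rwa [hd, sub_self, norm_zero]⟩
    | hadd x y hx hy =>
      obtain ⟨c, hc⟩ := hx (ε / 2) (half_pos hε)
      obtain ⟨c', hc'⟩ := hy (ε / 2) (half_pos hε)
      refine ⟨c + c', (hc.and hc').mono fun d hd => ?_⟩
      calc _ = ‖(star (z d) * x * z d - c • (1 : A)) + (star (z d) * y * z d - c' • (1 : A))‖ := by
            rw [mul_add, add_mul, add_smul, add_sub_add_comm]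
        _ < ε := (norm_add_le _ _).trans_lt (by linarith [hd.1, hd.2])
    | hclosed x hx =>
      obtain ⟨y, hy, hxy⟩ := hx (ε / 2) (half_pos hε)
      obtain ⟨c, hc⟩ := hy (ε / 2) (half_pos hε)
      refine ⟨c, hc.mono fun d hd => ?_⟩
      calc _ = ‖star (z d) * (x - y) * z d + (star (z d) * y * z d - c • (1 : A))‖ := by
            rw [mul_sub, sub_mul, sub_add_sub_cancel]
        _ < ε := (norm_add_le _ _).trans_lt
            (by linarith [norm_conj_isometry_le (hz d) (x - y)])
  exact ⟨z, ω, hω, fun e e' f f' hne x hx =>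
    hω.eq_of_eventually (hunbal e e' f f' hne x hx)⟩

end IsQCuntzPair

end State

/-! ### Completely positive approximation -/

section Approximation

open Filter Topology

variable {A : Type*} [CStarAlgebra A] {n m : ℕ}

/-- The number of pairs `(i, j)` in `{0, …, K}²` with `i + e' = j + e`. -/
def countShift (K e e' : ℕ) : ℕ :=
  (Finset.univ.filter fun p : Fin (K + 1) × Fin (K + 1) => (p.1 : ℕ) + e' = p.2 + e).card

theorem countShift_le (K e e' : ℕ) : countShift K e e' ≤ K + 1 := by
  have : countShift K e e' ≤ (Finset.univ : Finset (Fin (K + 1))).card := by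
    refine Finset.card_le_card_of_injOn Prod.fst
      (fun _ _ => Finset.mem_coe.2 (Finset.mem_univ _)) ?_
    rintro ⟨i, j⟩ hp ⟨i', j'⟩ hp' (rfl : i = i')
    simp only [Finset.coe_filter, Finset.mem_univ, true_and, Set.mem_ofPred_eq] at hp hp'
    exact Prod.ext rfl (Fin.ext (by simp only; omega))
  simpa using this

theorem le_countShift (K e e' : ℕ) : K + 1 - (e + e') ≤ countShift K e e' := by
  have : (Finset.univ : Finset (Fin (K + 1 - (e + e')))).card ≤ countShift K e e' := by
    refine Finset.card_le_card_of_injOn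
      (fun i => (⟨i + e, by omega⟩, ⟨i + e', by omega⟩)) (fun i _ => ?_) ?_
    · simp only [Finset.coe_filter, Finset.mem_univ, true_and, Set.mem_ofPred_eq]
      omega
    · intro i _ j _ hij
      simp only [Prod.mk.injEq, Fin.mk.injEq] at hij
      exact Fin.ext (by omega)
  simpa using this

theorem tendsto_countShift (e e' : ℕ) :
    Tendsto (fun K : ℕ => (countShift K e e' : ℝ) / (K + 1)) atTop (𝓝 1) := by
  have h1 : Tendsto (fun K : ℕ => 1 - ((e + e' : ℕ) : ℝ) * (1 / ((K : ℝ) + 1))) atTop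
      (𝓝 (1 - ((e + e' : ℕ) : ℝ) * 0)) :=
    tendsto_const_nhds.sub (tendsto_one_div_add_atTop_nhds_zero_nat.const_mul _)
  rw [mul_zero, sub_zero] at h1
  refine tendsto_of_tendsto_of_tendsto_of_le_of_le h1 tendsto_const_nhds (fun K => ?_) fun K => ?_
  · have h2 : ((K + 1 : ℕ) : ℝ) ≤ countShift K e e' + (e + e' : ℕ) := by
      have := le_countShift K e e'
      exact_mod_cast (by omega : K + 1 ≤ countShift K e e' + (e + e'))
    have hK : (0 : ℝ) < (K : ℝ) + 1 := by positivity
    rw [le_div_iff₀ hK, sub_mul, mul_assoc, one_div_mul_cancel hK.ne']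
    push_cast at h2 ⊢
    linarith
  · have hK : (0 : ℝ) < (K : ℝ) + 1 := by positivity
    rw [div_le_one hK]
    exact_mod_cast countShift_le K e e'

namespace IsQCuntzPair

variable {q : ℂ} {s : Fin n → A} {t : Fin m → A} (h : IsQCuntzPair q s t)
include h

theorem exists_biWords (d e : ℕ) : ∃ (N : ℕ) (w : Fin N → A),
    (∀ a, w a ∈ biWordSpan s t d 0 e 0) ∧ IsCuntzFamily w := by
  obtain ⟨N, w, hw, hcw⟩ := h.left.exists_words d
  obtain ⟨M, v, hv, hcv⟩ := h.right.exists_words e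
  refine ⟨N * M, _, fun a => ?_, (hcw.mul hcv).comp_equiv finProdFinEquiv.symm⟩
  simp only [biWordSpan, wordSpan, pow_zero, mul_one]
  exact Submodule.mul_mem_mul (hw _) (hv _)

variable {ω : A →ₗ[ℂ] ℂ} (hω1 : ω 1 = 1)
  (hω : ∀ e e' f f', ¬ (e = e' ∧ f = f') → ∀ x ∈ biWordSpan s t e e' f f', ω x = 0)
include hω1 hω

/-- The compression of a word to the words of lengths `(d, g)` on the left and `(d', g')` on the
right is the word itself if the lengths match, and vanishes otherwise. -/
theorem sum_compress {N N' d d' g g' e e' f f' : ℕ} {w : Fin N → A} {w' : Fin N' → A}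
    (hw : ∀ a, w a ∈ biWordSpan s t d 0 g 0) (hcw : IsCuntzFamily w)
    (hw' : ∀ a, w' a ∈ biWordSpan s t d' 0 g' 0) (hcw' : IsCuntzFamily w') {x : A}
    (hx : x ∈ biWordSpan s t e e' f f') (he : e ≤ d) (hf : f ≤ g) :
    ∑ a, ∑ b, ω (star (w a) * x * w' b) • (w a * star (w' b)) =
      if d + e' = d' + e ∧ g + f' = g' + f then x else 0 := by
  have hmem : ∀ a b, star (w a) * x * w' b ∈ biWordSpan s t (d' - (e' + (d - e)))
      (e' + (d - e) - d') (g' - (f' + (g - f))) (f' + (g - f) - g') := by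
    intro a b
    have h1 := h.biWordSpan_mul_le _ _ _ _ _ _ _ _
      (Submodule.mul_mem_mul (h.star_mem_biWordSpan _ (hw a)) hx)
    have h2 := h.biWordSpan_mul_le _ _ _ _ _ _ _ _ (Submodule.mul_mem_mul h1 (hw' b))
    simpa [Nat.sub_eq_zero_of_le he, Nat.sub_eq_zero_of_le hf] using h2
  split_ifs with hb
  · have hsc : ∀ a b, ω (star (w a) * x * w' b) • (1 : A) = star (w a) * x * w' b := by
      intro a b
      have := hmem a b
      have e1 : d' - (e' + (d - e)) = 0 := by omega
      have e2 : e' + (d - e) - d' = 0 := by omega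
      have e3 : g' - (f' + (g - f)) = 0 := by omega
      have e4 : f' + (g - f) - g' = 0 := by omega
      rw [e1, e2, e3, e4, biWordSpan, wordSpan, wordSpan] at this
      simp only [pow_zero, mul_one] at this
      obtain ⟨c, hc⟩ := Submodule.mem_one.1 this
      rw [← hc, Algebra.algebraMap_eq_smul_one, map_smul, hω1, smul_eq_mul, mul_one]
    calc _ = ∑ a, ∑ b, w a * (star (w a) * x * w' b) * star (w' b) := by
          refine Finset.sum_congr rfl fun a _ => Finset.sum_congr rfl fun b _ => ?_
          rw [← hsc a b, mul_smul_comm, mul_one, smul_mul_assoc, map_smul, hω1, smul_eq_mul,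
            mul_one]
      _ = (∑ a, w a * star (w a)) * x * ∑ b, w' b * star (w' b) := by
          simp only [Finset.sum_mul, Finset.mul_sum, mul_assoc]
          exact Finset.sum_comm
      _ = x := by rw [hcw.total, hcw'.total, one_mul, mul_one]
  · refine Finset.sum_eq_zero fun a _ => Finset.sum_eq_zero fun b _ => ?_
    rw [hω _ _ _ _ (by omega) _ (hmem a b), zero_smul]

/-- Compressing to the words of lengths between `K` and `2K` and averaging back approximates the
identity. -/
theorem exists_approx : ∃ (k : ℕ → ℕ) (w : ∀ K, Fin (k K) → A),
    (∀ K a, star (w K a) * w K a = 1) ∧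
    (∀ K a b, ω (star (w K a) * w K b) = if a = b then 1 else 0) ∧
    (∀ K : ℕ, ∑ a, (((K : ℂ) + 1)⁻¹ • w K a) * star (((K : ℂ) + 1)⁻¹ • w K a) = 1) ∧
    ∀ e e' f f', ∀ x ∈ biWordSpan s t e e' f f', Tendsto (fun K : ℕ => ∑ a, ∑ b,
      ω (star (w K a) * x * w K b) • ((((K : ℂ) + 1)⁻¹ • w K a) * star (((K : ℂ) + 1)⁻¹ • w K b)))
      atTop (𝓝 x) := by
  choose N v hv hcv using h.exists_biWords
  let ι (K : ℕ) := Σ D : Fin (K + 1) × Fin (K + 1), Fin (N (K + D.1) (K + D.2))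
  let W (K : ℕ) (a : ι K) : A := v (K + a.1.1) (K + a.1.2) a.2
  let eq (K : ℕ) : Fin (Fintype.card (ι K)) ≃ ι K := (Fintype.equivFin (ι K)).symm
  have hsig : ∀ K (g : ι K → A), ∑ a, g a = ∑ D, ∑ a, g ⟨D, a⟩ := fun K g =>
    Fintype.sum_sigma g
  have hre : ∀ K (g : ι K → ι K → A), ∑ a, ∑ b, g (eq K a) (eq K b) = ∑ a, ∑ b, g a b := by
    intro K g
    rw [← (eq K).sum_comp]
    exact Finset.sum_congr rfl fun a _ => (eq K).sum_comp (g (eq K a))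
  have hstar : ∀ (K : ℕ) (a b : A), (((K : ℂ) + 1)⁻¹ • a) * star (((K : ℂ) + 1)⁻¹ • b) =
      (((K : ℂ) + 1)⁻¹ * ((K : ℂ) + 1)⁻¹) • (a * star b) := by
    intro K a b
    rw [star_smul, smul_mul_smul_comm]
    congr 2
    simp
  refine ⟨fun K => Fintype.card (ι K), fun K => W K ∘ eq K, fun K a => ?_, fun K a b => ?_,
    fun K => ?_, fun e e' f f' x hx => ?_⟩
  · have := (hcv _ _).orthogonal (eq K a).2 (eq K a).2
    rwa [if_pos rfl] at this
  · suffices hab : ∀ a b : ι K, ω (star (W K a) * W K b) = if a = b then 1 else 0 by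
      simpa using hab (eq K a) (eq K b)
    clear a b
    intro a b
    obtain ⟨⟨D1, D2⟩, a⟩ := a
    obtain ⟨⟨D1', D2'⟩, b⟩ := b
    by_cases hD : D1 = D1' ∧ D2 = D2'
    · obtain ⟨rfl, rfl⟩ := hD
      simp only [W, (hcv _ _).orthogonal]
      by_cases hab : a = b
      · subst hab
        rw [if_pos rfl, if_pos rfl, hω1]
      · rw [if_neg hab, map_zero, if_neg]
        exact fun hs => hab (eq_of_heq (Sigma.mk.inj hs).2)
    · rw [if_neg fun hab => hD (by simpa using congrArg Sigma.fst hab)]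
      have h1 := h.biWordSpan_mul_le _ _ _ _ _ _ _ _
        (Submodule.mul_mem_mul (h.star_mem_biWordSpan _ (hv (K + D1) (K + D2) a))
          (hv (K + D1') (K + D2') b))
      refine hω _ _ _ _ (fun hb => hD ?_) _ h1
      constructor <;> apply Fin.ext <;> omega
  · simp only [hstar, Function.comp_apply, ← Finset.smul_sum]
    rw [(eq K).sum_comp fun a => W K a * star (W K a), hsig]
    simp only [W, (hcv _ _).total, Finset.sum_const, Finset.card_univ, Fintype.card_prod,
      Fintype.card_fin]
    rw [← Nat.cast_smul_eq_nsmul ℂ, smul_smul]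
    have : ((K : ℂ) + 1) ≠ 0 := Nat.cast_add_one_ne_zero K
    push_cast
    rw [show ((K : ℂ) + 1)⁻¹ * ((K : ℂ) + 1)⁻¹ * ((K + 1) * (K + 1)) = 1 by field_simp, one_smul]
  · have hsum : ∀ K, e ≤ K → f ≤ K → ∑ a, ∑ b, ω (star (W K (eq K a)) * x * W K (eq K b)) •
        ((((K : ℂ) + 1)⁻¹ • W K (eq K a)) * star (((K : ℂ) + 1)⁻¹ • W K (eq K b))) =
        (((countShift K e e' : ℝ) / (K + 1) * ((countShift K f f' : ℝ) / (K + 1)) : ℝ) : ℂ) •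
          x := by
      intro K he hf
      rw [hre K fun a b => ω (star (W K a) * x * W K b) •
        ((((K : ℂ) + 1)⁻¹ • W K a) * star (((K : ℂ) + 1)⁻¹ • W K b))]
      simp only [hstar, smul_comm (ω _), ← Finset.smul_sum]
      have hblock : ∑ a, ∑ b, ω (star (W K a) * x * W K b) • (W K a * star (W K b)) =
          ((countShift K e e' * countShift K f f' : ℕ) : ℂ) • x := by
        simp only [hsig]
        calc _ = ∑ D : Fin (K + 1) × Fin (K + 1), ∑ D' : Fin (K + 1) × Fin (K + 1),
              ∑ a, ∑ b, ω (star (v (K + D.1) (K + D.2) a) * x * v (K + D'.1) (K + D'.2) b) •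
                (v (K + D.1) (K + D.2) a * star (v (K + D'.1) (K + D'.2) b)) :=
            Finset.sum_congr rfl fun D _ => Finset.sum_comm
          _ = ∑ D : Fin (K + 1) × Fin (K + 1), ∑ D' : Fin (K + 1) × Fin (K + 1),
              ((if (D.1 : ℕ) + e' = D'.1 + e then 1 else 0) *
                (if (D.2 : ℕ) + f' = D'.2 + f then 1 else 0) : ℂ) • x := by
            refine Finset.sum_congr rfl fun D _ => Finset.sum_congr rfl fun D' _ => ?_
            rw [h.sum_compress hω1 hω (hv _ _) (hcv _ _) (hv _ _) (hcv _ _) hx (by omega)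
              (by omega)]
            rw [ite_zero_mul_ite_zero, mul_one, ite_smul, one_smul, zero_smul]
            congr 1
            rw [eq_iff_iff]
            omega
          _ = _ := by
            simp only [← Finset.sum_smul]
            congr 1
            simp only [countShift, Finset.card_filter, Nat.cast_mul, Nat.cast_sum,
              Fintype.sum_prod_type, Nat.cast_ite, Nat.cast_one, Nat.cast_zero,
              Finset.sum_mul_sum]
      rw [hblock, smul_smul]
      congr 1
      push_cast
      field_simp
    have hlim : Tendsto (fun K : ℕ => ((((countShift K e e' : ℝ) / (K + 1)) *
        ((countShift K f f' : ℝ) / (K + 1)) : ℝ) : ℂ) • x) atTop (𝓝 x) := by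
      have := (tendsto_countShift e e').mul (tendsto_countShift f f')
      have := ((Complex.continuous_ofReal.tendsto _).comp this).smul_const x
      simpa using this
    refine hlim.congr' ?_
    filter_upwards [eventually_ge_atTop e, eventually_ge_atTop f] with K he hf
    exact (hsum K he hf).symm

end IsQCuntzPair

end Approximation

/-! ### Nuclearity, simplicity and pure infiniteness -/

section Consequences

open Filter Topology

variable {A : Type*} [CStarAlgebra A] [Nontrivial A] {n m : ℕ}

namespace IsQCuntzPair

variable {q : ℂ} {s : Fin n → A} {t : Fin m → A} (h : IsQCuntzPair q s t)
include h

/-- The algebra carries a state `ω`, a limit of compressions by isometries, such that the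
compressions to finite families of `ω`-orthonormal isometries approximate the identity. -/
theorem exists_state_approx [PartialOrder A] [StarOrderedRing A] (hn : 2 ≤ n) (hm : 2 ≤ m) :
    ∃ (z : ℕ → A) (ω : A →ₗ[ℂ] ℂ) (_ : IsConjLimit z ω) (hω : IsState ω) (k : ℕ → ℕ)
      (w v : ∀ K, Fin (k K) → A),
      (∀ K a, star (w K a) * w K a = 1) ∧ (∀ K x, ‖compressCP hω (w K) x‖ ≤ ‖x‖) ∧
      (∀ K T, ‖synthCP (v K) T‖ ≤ ‖T‖) ∧
      ∀ x, Tendsto (fun K => synthCP (v K) (compressCP hω (w K) x)) atTop (𝓝 x) := by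
  have hij : (⟨0, by omega⟩ : Fin n) ≠ ⟨1, by omega⟩ := by simp
  have hkl : (⟨0, by omega⟩ : Fin m) ≠ ⟨1, by omega⟩ := by simp
  obtain ⟨z, ω, hz, hkill⟩ := h.exists_balanced_state hij hkl
  have hω : IsState ω := hz.isState
  obtain ⟨k, w, hiso, horth, htot, hlim⟩ := h.exists_approx hω.map_one hkill
  have hφ : ∀ K x, ‖compressCP hω (w K) x‖ ≤ ‖x‖ := fun K => norm_compressCP_le hω (horth K)
  have hψ : ∀ (K : ℕ) T, ‖synthCP (fun a => ((K : ℂ) + 1)⁻¹ • w K a) T‖ ≤ ‖T‖ := fun (K : ℕ) =>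
    norm_synthCP_le (htot K)
  refine ⟨z, ω, hz, hω, k, w, fun K a => ((K : ℂ) + 1)⁻¹ • w K a, hiso, hφ, hψ, fun x => ?_⟩
  induction x using h.induction_words with
  | hword e e' f f' x hx => exact hlim e e' f f' x hx
  | hadd x y hx hy => simpa only [map_add] using hx.add hy
  | hclosed x hx =>
    rw [Metric.tendsto_nhds]
    intro ε hε
    obtain ⟨y, hy, hxy⟩ := hx (ε / 3) (by positivity)
    filter_upwards [Metric.tendsto_nhds.1 hy (ε / 3) (by positivity)] with K hK
    rw [dist_eq_norm] at hK ⊢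
    set ψ := synthCP fun a => ((K : ℂ) + 1)⁻¹ • w K a
    set φ := compressCP hω (w K)
    have h1 : ‖ψ (φ (x - y))‖ < ε / 3 := ((hψ K _).trans (hφ K _)).trans_lt hxy
    calc ‖ψ (φ x) - x‖ = ‖ψ (φ (x - y)) + (ψ (φ y) - y) - (x - y)‖ := by
          rw [map_sub, map_sub]; congr 1; abel
      _ ≤ ‖ψ (φ (x - y))‖ + ‖ψ (φ y) - y‖ + ‖x - y‖ :=
          (norm_sub_le _ _).trans (by gcongr; exact norm_add_le _ _)
      _ < ε := by linarith

theorem isNuclear [PartialOrder A] [StarOrderedRing A] (hn : 2 ≤ n) (hm : 2 ≤ m) :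
    IsNuclearCStar A := by
  obtain ⟨z, ω, -, hω, k, w, v, -, hφ, hψ, hlim⟩ := h.exists_state_approx hn hm
  intro F ε hε
  have : ∀ᶠ K in atTop, ∀ a ∈ F, ‖synthCP (v K) (compressCP hω (w K) a) - a‖ < ε := by
    rw [Filter.eventually_all_finset]
    intro a _
    simpa only [dist_eq_norm] using Metric.tendsto_nhds.1 (hlim a) ε hε
  obtain ⟨K, hK⟩ := this.exists
  exact ⟨k K, compressCP hω (w K), synthCP (v K), hφ K, hψ K, hK⟩

/-- Every nonzero element is detected by the state `ω` after multiplication by isometries. -/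
theorem exists_state_ne_zero (hn : 2 ≤ n) (hm : 2 ≤ m) {x : A} (hx : x ≠ 0) :
    ∃ (z : ℕ → A) (ω : A →ₗ[ℂ] ℂ) (v w : A), IsConjLimit z ω ∧ star v * v = 1 ∧
      ω (star v * (x * w)) ≠ 0 := by
  let _ := CStarAlgebra.spectralOrder A
  have _ := CStarAlgebra.spectralOrderedRing A
  obtain ⟨z, ω, hz, hω, k, w, v, hiso, -, -, hlim⟩ := h.exists_state_approx hn hm
  by_contra! hcon
  refine hx (tendsto_nhds_unique (hlim x) (tendsto_const_nhds.congr fun K => ?_))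
  have : compressCP hω (w K) x = 0 := by
    ext a b : 1
    rw [compressCP_apply, mul_assoc]
    exact hcon z ω _ _ hz (hiso K a)
  rw [this, map_zero]

theorem exists_mul_mul_eq_one (hn : 2 ≤ n) (hm : 2 ≤ m) {x : A} (hx : x ≠ 0) :
    ∃ a b : A, a * x * b = 1 := by
  obtain ⟨z, ω, v, w, hz, -, hne⟩ := h.exists_state_ne_zero hn hm hx
  obtain ⟨d, u, hu⟩ := hz.exists_isUnit hne
  refine ⟨↑u⁻¹ * (star (z d) * star v), w * z d, ?_⟩
  calc _ = ↑u⁻¹ * (star (z d) * (star v * (x * w)) * z d) := by simp only [mul_assoc]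
    _ = 1 := by rw [← hu, Units.inv_mul]

/-- Some right multiple of a nonzero element is an isometry. The state is nonzero at
`(x w)^* (x w)`, so a compression of this positive element is invertible, and the inverse of its
square root normalizes it. -/
theorem exists_isometry_mul (hn : 2 ≤ n) (hm : 2 ≤ m) {x : A} (hx : x ≠ 0) :
    ∃ c : A, star (x * c) * (x * c) = 1 := by
  let _ := CStarAlgebra.spectralOrder A
  have _ := CStarAlgebra.spectralOrderedRing A
  obtain ⟨z, ω, v, w, hz, hv, hne⟩ := h.exists_state_ne_zero hn hm hx
  have hne' : ω (star (x * w) * (x * w)) ≠ 0 := by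
    intro h0
    have := hz.norm_sq_le (x := x * w) hv
    rw [h0, norm_zero] at this
    exact hne (norm_eq_zero.1 (pow_eq_zero_iff two_ne_zero |>.1 (le_antisymm this (sq_nonneg _))))
  obtain ⟨d, hu⟩ := hz.exists_isUnit hne'
  set y := x * (w * z d) with hy
  have hyy : star (z d) * (star (x * w) * (x * w)) * z d = star y * y := by
    simp only [hy, star_mul, mul_assoc]
  rw [hyy] at hu
  have hpos : IsStrictlyPositive (star y * y) := hu.isStrictlyPositive (star_mul_self_nonneg y)
  set g := (star y * y) ^ (-(1 / 2) : ℝ) with hg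
  have hgs : star g = g := (IsSelfAdjoint.of_nonneg CFC.rpow_nonneg).star_eq
  refine ⟨w * z d * g, ?_⟩
  have : star (x * (w * z d * g)) * (x * (w * z d * g)) = g * (star y * y) * g := by
    rw [← mul_assoc x, ← hy, star_mul, hgs]; simp only [mul_assoc]
  rw [this, hg]
  nth_rw 2 [← CFC.rpow_one (star y * y)]
  rw [← CFC.rpow_add hu, ← CFC.rpow_add hu]
  norm_num
  exact CFC.rpow_zero _

theorem isPurelyInfinite [PartialOrder A] [StarOrderedRing A] (hn : 2 ≤ n) (hm : 2 ≤ m) :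
    IsPurelyInfiniteCStar A := by
  intro B hB hne
  obtain ⟨x, hxB, hx⟩ : ∃ x ∈ B, x ≠ 0 := by
    by_contra! hcon
    exact hne (le_bot_iff.1 fun x hx => NonUnitalStarAlgebra.mem_bot.2 (hcon x hx))
  obtain ⟨c, hc⟩ := h.exists_isometry_mul hn hm hx
  set r := x * c with hr
  let s₀ := s ⟨0, by omega⟩
  have hs₀ : star s₀ * s₀ = 1 := by simpa using h.left.orthogonal ⟨0, by omega⟩ ⟨0, by omega⟩
  have hpm : r * star r ∈ B := by
    refine hB.mem_of_le _ (‖c * star c‖ • (x * star x)) (mul_star_self_nonneg r) ?_ ?_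
    · have := CStarAlgebra.star_right_conjugate_le_norm_smul (a := x) (b := c * star c)
        (IsSelfAdjoint.mul_star_self c)
      simpa only [hr, star_mul, mul_assoc] using this
    · rw [← Complex.coe_smul]
      exact B.smul_mem' _ (B.mul_mem hxB (B.star_mem' hxB))
  refine ⟨r * star r, hpm, ⟨?_, ?_⟩, r * s₀ * star r, ?_, ?_⟩
  · change r * star r * (r * star r) = _
    rw [mul_assoc, ← mul_assoc (star r), hc, one_mul]
  · exact IsSelfAdjoint.mul_star_self r
  · simp only [star_mul, star_star]
    calc _ = r * (star s₀ * (star r * r) * s₀) * star r := by simp only [mul_assoc]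
      _ = _ := by rw [hc, mul_one, hs₀, mul_one]
  · have e1 : r * s₀ * star r * star (r * s₀ * star r) = r * (s₀ * star s₀) * star r := by
      simp only [star_mul, star_star]
      calc _ = r * (s₀ * (star r * r) * star s₀) * star r := by simp only [mul_assoc]
        _ = _ := by rw [hc, mul_one]
    rw [e1]
    have hle : s₀ * star s₀ ≤ 1 := by
      refine (CStarAlgebra.norm_le_one_iff_of_nonneg _ (mul_star_self_nonneg _)).1 ?_
      have := norm_le_one_of_star_mul_self hs₀
      rw [CStarRing.norm_self_mul_star]
      nlinarith [norm_nonneg s₀]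
    refine lt_of_le_of_ne ?_ fun heq => ?_
    · simpa using star_right_conjugate_le_conjugate hle r
    · -- Equality would make `s₀` unitary, hence the other generators zero.
      have h1 : s₀ * star s₀ = 1 := by
        calc s₀ * star s₀ = (star r * r) * (s₀ * star s₀) * (star r * r) := by
              rw [hc, one_mul, mul_one]
          _ = star r * (r * (s₀ * star s₀) * star r) * r := by simp only [mul_assoc]
          _ = (star r * r) * (star r * r) := by rw [heq]; simp only [mul_assoc]
          _ = 1 := by rw [hc, one_mul]
      have h2 : star s₀ * s ⟨1, by omega⟩ = 0 := by
        rw [h.left.orthogonal, if_neg (by simp)]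
      have h3 : s ⟨1, by omega⟩ = 0 := by
        rw [← one_mul (s _), ← h1, mul_assoc, h2, mul_zero]
      have h4 := h.left.orthogonal ⟨1, by omega⟩ ⟨1, by omega⟩
      rw [if_pos rfl, h3, mul_zero] at h4
      exact zero_ne_one h4

theorem isSimpleRing (hn : 2 ≤ n) (hm : 2 ≤ m) : IsSimpleRing A := by
  rw [isSimpleRing_iff_isTwoSided_imp]
  refine ⟨inferInstance, fun I hI => or_iff_not_imp_left.2 fun hne => ?_⟩
  obtain ⟨x, hxI, hx⟩ := Submodule.exists_mem_ne_zero_of_ne_bot hne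
  obtain ⟨a, b, hab⟩ := h.exists_mul_mul_eq_one hn hm hx
  rw [Ideal.eq_top_iff_one, ← hab]
  exact I.mul_mem_right b (I.mul_mem_left a hxI)

end IsQCuntzPair

end Consequences

/-! ### A representation of the relations -/

section Representation

variable {X H : Type*} [NormedAddCommGroup H] [InnerProductSpace ℂ H]

theorem HilbertBasis.clm_ext (b : HilbertBasis X ℂ H) {S T : H →L[ℂ] H}
    (h : ∀ x, S (b x) = T (b x)) : S = T := by
  refine ContinuousLinearMap.ext_on (s := Set.range b) ?_ ?_
  · rw [dense_iff_closure_eq, ← Submodule.topologicalClosure_coe, b.dense_span]; rfl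
  · rintro _ ⟨x, rfl⟩
    exact h x

theorem HilbertBasis.clm_ext_inner (b : HilbertBasis X ℂ H) {S T : H →L[ℂ] H}
    (h : ∀ x y, inner ℂ (b x) (S (b y)) = inner ℂ (b x) (T (b y))) : S = T := by
  refine b.clm_ext fun y => b.repr.injective (lp.ext (funext fun x => ?_))
  simpa only [b.repr_apply_apply] using h x y

variable [CompleteSpace H]

/-- A decomposition of an index set into copies of itself, with phases, yields a Cuntz family. -/
theorem HilbertBasis.exists_isCuntzFamily (b : HilbertBasis X ℂ H) {ι : Type*} [Fintype ι]
    [DecidableEq ι] {f : ι → X → X} (hf : Function.Bijective fun p : ι × X => f p.1 p.2)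
    {c : X → ℂ} (hc : ∀ x, ‖c x‖ = 1) :
    ∃ S : ι → H →L[ℂ] H, IsCuntzFamily S ∧ ∀ i x, S i (b x) = c x • b (f i x) := by
  classical
  have hcc : ∀ x, (starRingEnd ℂ) (c x) * c x = 1 := fun x => by
    rw [mul_comm, Complex.mul_conj, Complex.normSq_eq_norm_sq, hc]; simp
  have hinner : ∀ i j x y, inner ℂ (c x • b (f i x)) (c y • b (f j y)) =
      if i = j ∧ x = y then (1 : ℂ) else 0 := by
    intro i j x y
    rw [inner_smul_left, inner_smul_right, orthonormal_iff_ite.1 b.orthonormal]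
    have : f i x = f j y ↔ i = j ∧ x = y := by
      have := hf.injective.eq_iff (a := (i, x)) (b := (j, y))
      simpa using this
    simp only [this]
    split_ifs with h
    · rw [← h.2, mul_one, hcc]
    · simp
  have hortho : ∀ i, Orthonormal ℂ fun x => c x • b (f i x) := fun i => by
    rw [orthonormal_iff_ite]
    intro x y
    simpa using hinner i i x y
  let S (i : ι) : H →L[ℂ] H := ((hortho i).orthogonalFamily.linearIsometry.comp
    b.repr.toLinearIsometry).toContinuousLinearMap
  have hS : ∀ i x, S i (b x) = c x • b (f i x) := by
    intro i x
    change (hortho i).orthogonalFamily.linearIsometry (b.repr (b x)) = _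
    rw [b.repr_self, OrthogonalFamily.linearIsometry_apply_single]
    simp
  have horth : ∀ i j, star (S i) * S j = if i = j then 1 else 0 := by
    intro i j
    refine b.clm_ext_inner fun x y => ?_
    change inner ℂ (b x) ((ContinuousLinearMap.adjoint (S i)) (S j (b y))) = _
    rw [ContinuousLinearMap.adjoint_inner_right, hS, hS, hinner]
    by_cases hij : i = j
    · simp only [hij, true_and, if_true, one_apply_eq_self,
        orthonormal_iff_ite.1 b.orthonormal]
    · simp [hij]
  refine ⟨S, ⟨horth, b.clm_ext fun y => ?_⟩, hS⟩
  obtain ⟨⟨i, x⟩, rfl⟩ := hf.surjective y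
  have hy : b (f i x) = (starRingEnd ℂ) (c x) • S i (b x) := by
    rw [hS, smul_smul, hcc, one_smul]
  have h1 : (∑ k, S k * star (S k)) * S i = S i := by
    simp [Finset.sum_mul, mul_assoc, horth]
  simp only [one_apply_eq_self]
  rw [hy, map_smul, ← mul_apply_eq_comp, h1]

/-- The relations between the isometries `s_j` and `t_r` imply those between `s_j^*` and `t_r`. -/
theorem star_mul_eq_of_mul_eq {A : Type*} [CStarAlgebra A] {n : ℕ} {q : ℂ} {s : Fin n → A} {t : A}
    (hs : IsCuntzFamily s) (h : ∀ j, t * s j = q • (s j * t)) (j : Fin n) :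
    star (s j) * t = q • (t * star (s j)) := by
  calc star (s j) * t = star (s j) * (t * ∑ k, s k * star (s k)) := by rw [hs.total, mul_one]
    _ = ∑ k, q • ((star (s j) * s k) * t * star (s k)) := by
      rw [Finset.mul_sum, Finset.mul_sum]
      refine Finset.sum_congr rfl fun k _ => ?_
      rw [← mul_assoc t, h]
      simp only [smul_mul_assoc, mul_smul_comm, mul_assoc]
    _ = _ := by simp [hs.orthogonal, ite_mul]

/-- There are nonzero C⋆-algebras, in every universe, with two Cuntz families satisfying the
twisted commutation relations. A basis is indexed by `ℤ × ℕ × ℕ`; the integer counts the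
generators `s_j`, and provides the phases for the generators `t_r`. -/
theorem exists_twisted_cuntzFamilies {n m : ℕ} (hn : n ≠ 0) (hm : m ≠ 0) {q : ℂ} (hq : ‖q‖ = 1) :
    ∃ ρ : QTwistedRep.{u} n m q, IsCuntzFamily ρ.s ∧ IsCuntzFamily ρ.t := by
  have _ : NeZero n := ⟨hn⟩
  have _ : NeZero m := ⟨hm⟩
  let X := ULift.{u} (ℤ × ℕ × ℕ)
  let H := lp (fun _ : X => ℂ) 2
  let b : HilbertBasis X ℂ H := .ofRepr (LinearIsometryEquiv.refl ℂ H)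
  let f (i : Fin n) (x : X) : X :=
    ⟨x.down.1 + 1, (Nat.divModEquiv n).symm (x.down.2.1, i), x.down.2.2⟩
  let g (r : Fin m) (x : X) : X :=
    ⟨x.down.1, x.down.2.1, (Nat.divModEquiv m).symm (x.down.2.2, r)⟩
  have hf : Function.Bijective fun p : Fin n × X => f p.1 p.2 := by
    refine Function.bijective_iff_has_inverse.2 ⟨fun x => ((Nat.divModEquiv n x.down.2.1).2,
      ⟨x.down.1 - 1, (Nat.divModEquiv n x.down.2.1).1, x.down.2.2⟩), fun p => ?_, fun x => ?_⟩
    · simp only [f, Equiv.apply_symm_apply, add_sub_cancel_right]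
      rfl
    · simp only [f, sub_add_cancel, Prod.mk.eta, Equiv.symm_apply_apply]
      rfl
  have hg : Function.Bijective fun p : Fin m × X => g p.1 p.2 := by
    refine Function.bijective_iff_has_inverse.2 ⟨fun x => ((Nat.divModEquiv m x.down.2.2).2,
      ⟨x.down.1, x.down.2.1, (Nat.divModEquiv m x.down.2.2).1⟩), fun p => ?_, fun x => ?_⟩
    · simp only [g, Equiv.apply_symm_apply]
      rfl
    · simp only [g, Prod.mk.eta, Equiv.symm_apply_apply]
      rfl
  have hq0 : q ≠ 0 := fun h => by simp [h] at hq
  obtain ⟨S, hS, hSb⟩ := b.exists_isCuntzFamily hf (c := fun _ => 1) (by simp)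
  obtain ⟨T, hT, hTb⟩ := b.exists_isCuntzFamily hg (c := fun x => q ^ x.down.1)
    (fun x => by rw [norm_zpow, hq, one_zpow])
  have _ : Nontrivial H := ⟨⟨b ⟨0, 0, 0⟩, 0, b.orthonormal.ne_zero _⟩⟩
  have hTS : ∀ j r, T r * S j = q • (S j * T r) := by
    intro j r
    refine b.clm_ext fun x => ?_
    simp only [mul_apply_eq_comp, smul_apply, hSb, hTb, map_smul,
      one_smul, smul_smul]
    congr 1
    simp only [f]
    rw [zpow_add_one₀ hq0, mul_comm]
  exact ⟨{ alg := H →L[ℂ] H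
           s := S
           t := T
           rel := ⟨hS.orthogonal, hT.orthogonal, fun j r =>
             star_mul_eq_of_mul_eq hS (fun j => hTS j r) j⟩ }, hS, hT⟩

end Representation

/-! ### The universal algebra -/

namespace CuntzQTensor

open QTwisted

variable (n m : ℕ) (q : ℂ)

/-- The quotient map. -/
noncomputable def mk : Universal.{u} n m q →⋆ₐ[ℂ] CuntzQTensor.{u} n m q where
  toFun x := (Submodule.Quotient.mk x : Universal.{u} n m q ⧸ idealM.{u} n m q)
  map_one' := rfl
  map_mul' _ _ := rfl
  map_zero' := rfl
  map_add' _ _ := rfl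
  commutes' _ := rfl
  map_star' _ := rfl

theorem mk_surjective : Function.Surjective (mk.{u} n m q) := Submodule.Quotient.mk_surjective _

theorem continuous_mk : Continuous (mk.{u} n m q) :=
  AddMonoidHomClass.continuous_of_bound _ 1 fun x => by
    rw [one_mul]
    exact CStarQuotient.norm_mk_le (idealM.{u} n m q) x

theorem mk_eq_zero {x : Universal.{u} n m q} : mk n m q x = 0 ↔ x ∈ idealM.{u} n m q :=
  Submodule.Quotient.mk_eq_zero _

theorem one_sub_range_mem :
    1 - rangeS.{u} n m q ∈ idealM.{u} n m q ∧ 1 - rangeT.{u} n m q ∈ idealM.{u} n m q := by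
  simp only [idealM, Submodule.mem_sInf]
  exact ⟨fun I hI => hI.2.2.1, fun I hI => hI.2.2.2⟩

theorem isCuntzFamily_s : IsCuntzFamily fun j => mk n m q (genS.{u} n m q j) where
  orthogonal i j := by
    rw [← map_star, ← map_mul, (isQTwistedPair_gen n m q).star_s_mul_s]
    split_ifs
    · exact map_one _
    · exact map_zero _
  total := by
    have h : mk n m q (1 - rangeS n m q) = 0 := (mk_eq_zero n m q).2 (one_sub_range_mem n m q).1
    rw [map_sub, map_one, sub_eq_zero, rangeS, map_sum] at h
    simpa only [map_mul, map_star] using h.symm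

theorem isCuntzFamily_t : IsCuntzFamily fun r => mk n m q (genT.{u} n m q r) where
  orthogonal i j := by
    rw [← map_star, ← map_mul, (isQTwistedPair_gen n m q).star_t_mul_t]
    split_ifs
    · exact map_one _
    · exact map_zero _
  total := by
    have h : mk n m q (1 - rangeT n m q) = 0 := (mk_eq_zero n m q).2 (one_sub_range_mem n m q).2
    rw [map_sub, map_one, sub_eq_zero, rangeT, map_sum] at h
    simpa only [map_mul, map_star] using h.symm

theorem dense_adjoin_gen : Dense (StarAlgebra.adjoin ℂ
    (Set.range (genS.{u} n m q) ∪ Set.range (genT.{u} n m q)) : Set (Universal.{u} n m q)) := by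
  have hmap : StarSubalgebra.map (universalSubalgebra.{u} n m q).subtype (StarAlgebra.adjoin ℂ
      (Set.range (genS.{u} n m q) ∪ Set.range (genT.{u} n m q))) = StarAlgebra.adjoin ℂ
      (Set.range (ambientS.{u} n m q) ∪ Set.range (ambientT.{u} n m q)) := by
    rw [StarAlgHom.map_adjoin, Set.image_union, ← Set.range_comp, ← Set.range_comp]
    rfl
  intro x
  rw [closure_subtype]
  have hx : (x : Ambient.{u} n m q) ∈ closure (StarAlgebra.adjoin ℂ
      (Set.range (ambientS.{u} n m q) ∪ Set.range (ambientT.{u} n m q)) :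
        Set (Ambient.{u} n m q)) := x.2
  rw [← hmap] at hx
  exact hx

theorem isQCuntzPair (hq : q ≠ 0) : IsQCuntzPair q (fun j => mk n m q (genS.{u} n m q j))
    fun r => mk n m q (genT.{u} n m q r) where
  ne_zero := hq
  left := isCuntzFamily_s n m q
  right := isCuntzFamily_t n m q
  star_s_mul_t j r := by
    rw [← map_star, ← map_mul, (isQTwistedPair_gen n m q).star_s_mul_t, map_smul, map_mul]
  dense := by
    have h := (mk_surjective n m q).denseRange.dense_image
      (continuous_mk n m q) (dense_adjoin_gen n m q)
    rw [← StarSubalgebra.coe_map, StarAlgHom.map_adjoin, Set.image_union, ← Set.range_comp,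
      ← Set.range_comp] at h
    exact h

theorem nontrivial (hn : n ≠ 0) (hm : m ≠ 0) (hq : ‖q‖ = 1) :
    Nontrivial (CuntzQTensor.{u} n m q) := by
  obtain ⟨ρ, hs, ht⟩ := exists_twisted_cuntzFamilies.{u} hn hm hq
  let φ := eval n m q ρ
  have hle : idealM.{u} n m q ≤ RingHom.ker φ := by
    refine sInf_le ⟨inferInstance, ?_, ?_, ?_⟩
    · exact isClosed_singleton.preimage (map_continuous φ)
    · rw [RingHom.mem_ker, map_sub, map_one, rangeS, map_sum, sub_eq_zero, ← hs.total]
      simp only [map_mul, map_star]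
      rfl
    · rw [RingHom.mem_ker, map_sub, map_one, rangeT, map_sum, sub_eq_zero, ← ht.total]
      simp only [map_mul, map_star]
      rfl
  refine ⟨⟨1, 0, fun h => ?_⟩⟩
  rw [← map_one (mk n m q), mk_eq_zero] at h
  exact one_ne_zero ((map_one φ).symm.trans ((RingHom.mem_ker).1 (hle h)))

end CuntzQTensor

theorem mainTheorem3 (n m : ℕ) (hn : 2 ≤ n) (hm : 2 ≤ m) (q : ℂ) (hq : ‖q‖ = 1) :
    IsNuclearCStar (CuntzQTensor.{u} n m q) ∧
    IsSimpleRing (CuntzQTensor.{u} n m q) ∧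
    IsPurelyInfiniteCStar (CuntzQTensor.{u} n m q) ∧
    ∀ x : CuntzQTensor.{u} n m q, x ≠ 0 → ∃ a b : CuntzQTensor.{u} n m q, a * x * b = 1 := by
  have _ := CuntzQTensor.nontrivial.{u} n m q (by omega) (by omega) hq
  have h := CuntzQTensor.isQCuntzPair.{u} n m q (fun h => by simp [h] at hq)
  exact ⟨h.isNuclear hn hm, h.isSimpleRing hn hm, h.isPurelyInfinite hn hm,
    fun x hx => h.exists_mul_mul_eq_one hn hm hx⟩
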